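/- Let $F$ be a $p$-adic field, that is, a field with a nontrivial non-archimedean absolute value $|\cdot|$ for which it is locally compact (for example a finite extension of $\mathbb{Q}_p$). Let $\mathcal{O}_F=\{x\in F : |x|\le 1\}$ and let $\varpi$ be a generator of the maximal ideal of $\mathcal{O}_F$. Let $n\ge 1$ and $m\ge 1$ be integers, and let $$K=K_m=\{x\in \mathrm{GL}_n(F) : \max_{i,j}|(1-x)_{ij}|\le |\varpi|^m\},$$ a congruence subgroup of $\mathrm{GL}_n(\mathcal{O}_F)$. Let $(\pi,V)$ be an irreducible complex representation of $\mathrm{GL}_n(F)$ that is smooth (every vector is fixed by some compact open subgroup) and admissible (the space of vectors fixed by any given compact open subgroup is finite-dimensional). Then the space $V^K$ of $K$-fixed vectors satisfies $$\dim_{\mathbb{C}} V^K\le [\mathrm{GL}_n(\mathcal{O}_F):K]^n\cdot n^{n/2}.$$ Moreover, for $n\ge 3$ this bound is strictly smaller than Bernstein's bound $[\mathrm{GL}_n(\mathcal{O}_F):K]^{2^{n-1}}$: $$[\mathrm{GL}_n(\mathcal{O}_F):K]^n\cdot n^{n/2}<[\mathrm{GL}_n(\mathcal{O}_F):K]^{2^{n-1}}.$$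 -/

import Mathlib

open scoped MatrixGroups

namespace UniformAdmissibility

section Representations

variable {G V : Type*} [Group G] [AddCommGroup V] [Module ℂ V]

/-- The subspace `V^K` of vectors fixed by every element of the subgroup `K`. -/
noncomputable def fixedVectors (π : Representation ℂ G V) (K : Subgroup G) : Submodule ℂ V :=
  Representation.invariants (π.comp K.subtype)

variable [TopologicalSpace G]

/-- Every vector is fixed by some compact open subgroup. -/
def IsSmooth (π : Representation ℂ G V) : Prop :=
  ∀ v : V, ∃ K : Subgroup G, IsOpen (K : Set G) ∧ IsCompact (K : Set G) ∧
    ∀ g ∈ K, π g v = v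

/-- `V^K` is finite-dimensional for every compact open subgroup `K`. -/
def IsAdmissible (π : Representation ℂ G V) : Prop :=
  ∀ K : Subgroup G, IsOpen (K : Set G) → IsCompact (K : Set G) →
    FiniteDimensional ℂ (fixedVectors π K)

end Representations

section Groups

theorem one_entry_le {E : Type*} [NormedField E] {n : ℕ} (i j : Fin n) :
    ‖(1 : Matrix (Fin n) (Fin n) E) i j‖ ≤ 1 := by
  rw [Matrix.one_apply]; split <;> simp

variable (F : Type*) [NontriviallyNormedField F] [IsUltrametricDist F]

/-- The ring of integers `{x : F | ‖x‖ ≤ 1}`. -/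
noncomputable abbrev integers : ValuationSubring F :=
  (NormedField.valuation (K := F)).valuationSubring

/-- The subgroup `GL_n(O_F)` of `GL_n(F)`. -/
noncomputable def integralGL (n : ℕ) : Subgroup (GL (Fin n) F) :=
  (Matrix.GeneralLinearGroup.map (n := Fin n) (algebraMap (integers F) F)).range

variable {F}

/-- `ϖ` generates the maximal ideal of the ring of integers. -/
def IsUniformizer (ϖ : integers F) : Prop :=
  IsLocalRing.maximalIdeal (integers F) = Ideal.span {ϖ}

theorem IsUniformizer.norm_lt_one {ϖ : integers F} (h : IsUniformizer ϖ) : ‖(ϖ : F)‖ < 1 := by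
  have h1 : ϖ ∈ IsLocalRing.maximalIdeal (integers F) := by
    rw [h]; exact Ideal.mem_span_singleton_self ϖ
  have h2 := (Valuation.mem_maximalIdeal_iff (v := NormedField.valuation (K := F)) (a := ϖ)).1 h1
  exact h2

theorem mul_entry_le {n : ℕ} {A B : Matrix (Fin n) (Fin n) F} {a b : ℝ} (ha : 0 ≤ a) (hb : 0 ≤ b)
    (hA : ∀ i j, ‖A i j‖ ≤ a) (hB : ∀ i j, ‖B i j‖ ≤ b) (i j : Fin n) :
    ‖(A * B) i j‖ ≤ a * b := by
  rw [Matrix.mul_apply]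
  refine IsUltrametricDist.norm_sum_le_of_forall_le_of_nonneg (mul_nonneg ha hb) fun k _ => ?_
  rw [norm_mul]
  exact mul_le_mul (hA i k) (hB k j) (norm_nonneg _) ha

theorem add_entry_le {x y : F} {c : ℝ} (hx : ‖x‖ ≤ c) (hy : ‖y‖ ≤ c) : ‖x + y‖ ≤ c :=
  (IsUltrametricDist.norm_add_le_max x y).trans (max_le hx hy)

theorem inv_entry_le {n : ℕ} {c : ℝ} (hc0 : 0 ≤ c) (hc1 : c < 1) (x : GL (Fin n) F)
    (hx : ∀ i j, ‖(1 - (x : Matrix (Fin n) (Fin n) F)) i j‖ ≤ c) (i j : Fin n) :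
    ‖((x⁻¹ : GL (Fin n) F) : Matrix (Fin n) (Fin n) F) i j‖ ≤ 1 := by
  set y : Matrix (Fin n) (Fin n) F := ((x⁻¹ : GL (Fin n) F) : Matrix (Fin n) (Fin n) F) with hy
  have hyx : y * (x : Matrix (Fin n) (Fin n) F) = 1 := by
    rw [hy, ← Units.val_mul, inv_mul_cancel, Units.val_one]
  have key : y = 1 + y * (1 - (x : Matrix (Fin n) (Fin n) F)) := by
    rw [mul_sub, hyx, mul_one]; abel
  obtain ⟨p, -, hp⟩ := Finset.exists_max_image (Finset.univ : Finset (Fin n × Fin n))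
    (fun p => ‖y p.1 p.2‖) ⟨(i, j), Finset.mem_univ _⟩
  have hM : ∀ k l, ‖y k l‖ ≤ ‖y p.1 p.2‖ := fun k l => hp (k, l) (Finset.mem_univ _)
  have h2 := mul_entry_le (norm_nonneg _) hc0 hM hx p.1 p.2
  have h3 : ‖y p.1 p.2‖ ≤ max 1 (‖y p.1 p.2‖ * c) := by
    have : y p.1 p.2 = (1 : Matrix (Fin n) (Fin n) F) p.1 p.2 +
        (y * (1 - (x : Matrix (Fin n) (Fin n) F))) p.1 p.2 := by
      rw [← Matrix.add_apply, ← key]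
    calc ‖y p.1 p.2‖ = _ := congrArg norm this
      _ ≤ _ := IsUltrametricDist.norm_add_le_max _ _
      _ ≤ _ := max_le_max (one_entry_le _ _) h2
  refine (hM i j).trans ?_
  rcases le_max_iff.1 h3 with h | h
  · exact h
  · nlinarith [norm_nonneg (y p.1 p.2)]

/-- The congruence subgroup `K_m = {x ∈ GL_n(F) | ‖1 - x‖ ≤ ‖ϖ‖ ^ m}` for `m ≥ 1`, where
`‖·‖` of a matrix is the maximum of the absolute values of its entries. -/
def congruenceSubgroup (n : ℕ) {ϖ : integers F} (hϖ : IsUniformizer ϖ) (m : ℕ) (hm : 1 ≤ m) :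
    Subgroup (GL (Fin n) F) where
  carrier := {x | ∀ i j, ‖(1 - (x : Matrix (Fin n) (Fin n) F)) i j‖ ≤ ‖(ϖ : F)‖ ^ m}
  one_mem' := fun i j => by simp
  mul_mem' := by
    intro x y hx hy i j
    have hc1 : ‖(ϖ : F)‖ ^ m ≤ 1 := pow_le_one₀ (norm_nonneg _) hϖ.norm_lt_one.le
    have e : 1 - ((x * y : GL (Fin n) F) : Matrix (Fin n) (Fin n) F)
        = (1 - (x : Matrix (Fin n) (Fin n) F)) + x * (1 - (y : Matrix (Fin n) (Fin n) F)) := by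
      rw [Units.val_mul, mul_sub, mul_one]; abel
    have hx1 : ∀ k l, ‖(x : Matrix (Fin n) (Fin n) F) k l‖ ≤ 1 := fun k l => by
      have : (x : Matrix (Fin n) (Fin n) F) k l = (1 : Matrix (Fin n) (Fin n) F) k l +
          -((1 - (x : Matrix (Fin n) (Fin n) F)) k l) := by
        rw [Matrix.sub_apply]; ring
      rw [this]
      exact add_entry_le (one_entry_le k l) (by rw [norm_neg]; exact (hx k l).trans hc1)
    rw [e, Matrix.add_apply]
    refine add_entry_le (hx i j) ?_
    simpa using mul_entry_le zero_le_one (by positivity) hx1 hy i j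
  inv_mem' := by
    intro x hx i j
    have hc1 : ‖(ϖ : F)‖ ^ m < 1 := pow_lt_one₀ (norm_nonneg _) hϖ.norm_lt_one (by omega)
    have e : 1 - ((x⁻¹ : GL (Fin n) F) : Matrix (Fin n) (Fin n) F)
        = -(((x⁻¹ : GL (Fin n) F) : Matrix (Fin n) (Fin n) F) *
          (1 - (x : Matrix (Fin n) (Fin n) F))) := by
      rw [mul_sub, mul_one, ← Units.val_mul, inv_mul_cancel, Units.val_one]; abel
    rw [e, Matrix.neg_apply, norm_neg]
    simpa using mul_entry_le zero_le_one (by positivity)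
      (inv_entry_le (by positivity) hc1 x hx) hx i j

end Groups

end UniformAdmissibility

/-! Write `D = dim V^K`, `N = [GL_n(O_F) : K]`, `l = n - 1`. By irreducibility and Burnside's
theorem the Hecke operators `e ∘ π g` span `End (V^K)` (`span_range_hecke_eq_top`), a space of
dimension `D ^ 2`. Cartan decomposition writes `g = P d R` with `P`, `R` integral and `d` diagonal.
Integral matrices normalize `K`, the centre acts on `V^K` by scalars, and the operators of dominant
diagonal matrices multiply (`coweight_factorization`). So every Hecke operator lies in a sum of `N ^
2` spaces `h C h'`, where `C` is the commutative algebra generated by the `l` fundamental coweights.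
This gives `D ^ 2 ≤ N ^ 2 * dim C` (`finrank_sq_le`).

The second input is pure linear algebra (`finrank_adjoin_range_le`): `l` commuting operators on a
`D`-dimensional space generate an algebra of dimension at most `(l + 1) * t ^ l`, where `t ^ (l + 1)
= D ^ 2`. For each generator one picks a polynomial of degree below about `t` whose multiples in the
algebra form a space of dimension at most about `D ^ 2 / t`; modulo all these polynomials only about
`t ^ l` monomials survive.

Together, `t ^ n = D ^ 2 ≤ N ^ 2 * n * t ^ (n - 1)`, so `t ≤ N ^ 2 * n`, and the `n`-th power is the
square of the claimed bound. The comparison with Bernstein's bound needs only `n ! ≤ N`, which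
permutation matrices provide. -/

open scoped MatrixGroups

namespace UniformAdmissibility

/-! ### Dimension of commutative algebras of operators; Burnside's theorem. -/

section LinearAlgebra

open Module Polynomial

variable {k : Type*} [Field k]

/-- The space of linear maps `φ` with `φ ∘ f = f' ∘ φ`. -/
def intertwiners {W W' : Type*} [AddCommGroup W] [Module k W] [AddCommGroup W'] [Module k W']
    (f : End k W) (f' : End k W') : Submodule k (W →ₗ[k] W') where
  carrier := {φ | φ ∘ₗ f = f' ∘ₗ φ}
  add_mem' := by
    intro a b ha hb
    simp only [Set.mem_ofPred_eq] at *
    rw [LinearMap.add_comp, LinearMap.comp_add, ha, hb]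
  zero_mem' := by simp
  smul_mem' := by
    intro c a ha
    simp only [Set.mem_ofPred_eq] at *
    rw [LinearMap.smul_comp, LinearMap.comp_smul, ha]

theorem mem_intertwiners {W W' : Type*} [AddCommGroup W] [Module k W] [AddCommGroup W']
    [Module k W'] {f : End k W} {f' : End k W'} {φ : W →ₗ[k] W'} :
    φ ∈ intertwiners f f' ↔ ∀ w, φ (f w) = f' (φ w) :=
  ⟨fun h w => LinearMap.congr_fun h w, fun h => LinearMap.ext h⟩

/-- Peel off one dimension of `W'` at a time. An eigenvector `ℓ` of the transpose of `f'` has an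
invariant hyperplane as kernel. Composing an intertwiner with `ℓ` gives a functional vanishing on
the range of `f - c`, and `hg` leaves at most `g` dimensions of those; the intertwiners killed by
`ℓ` land in the hyperplane. -/
theorem finrank_intertwiners_le [IsAlgClosed k] {W : Type*} [AddCommGroup W] [Module k W]
    [FiniteDimensional k W] (f : End k W) (g : ℕ)
    (hg : ∀ c : k, finrank k W ≤ g + finrank k (LinearMap.range (f - algebraMap k (End k W) c)))
    {W' : Type*} [AddCommGroup W'] [Module k W'] [FiniteDimensional k W'] (f' : End k W') :
    finrank k (intertwiners f f') ≤ g * finrank k W' := by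
  induction hN : finrank k W' generalizing W' with
  | zero =>
    have : Subsingleton W' := finrank_zero_iff.1 hN
    simp [finrank_zero_of_subsingleton]
  | succ N ih =>
    have : Nontrivial W' := nontrivial_of_finrank_pos (R := k) (by omega)
    obtain ⟨c, hc⟩ := Module.End.exists_eigenvalue (Module.Dual.transpose (R := k) f')
    obtain ⟨ℓ, hℓ⟩ := hc.exists_hasEigenvector
    have hℓ' : ∀ w, ℓ (f' w) = c * ℓ w := fun w => LinearMap.congr_fun hℓ.apply_eq_smul w
    set U := LinearMap.ker ℓ with hU
    have hUf : ∀ w ∈ U, f' w ∈ U := fun w hw => by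
      rw [hU, LinearMap.mem_ker] at hw ⊢
      rw [hℓ', hw, mul_zero]
    have hUN : finrank k U = N := by
      have h1 := LinearMap.finrank_range_add_finrank_ker ℓ
      rw [LinearMap.range_eq_top.2 (LinearMap.surjective hℓ.2), finrank_top,
        finrank_self, ← hU] at h1
      omega
    have ih' := ih (f'.restrict hUf) hUN
    let Φ : intertwiners f f' →ₗ[k] (W →ₗ[k] k) :=
      (LinearMap.compRight k (M := W) ℓ) ∘ₗ (intertwiners f f').subtype
    have hΦ : ∀ φ w, Φ φ w = ℓ (φ.1 w) := fun _ _ => rfl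
    have h1 := LinearMap.finrank_range_add_finrank_ker Φ
    have hr : LinearMap.range Φ ≤
        (LinearMap.range (f - algebraMap k (End k W) c)).dualAnnihilator := by
      rintro _ ⟨φ, rfl⟩
      rw [Submodule.mem_dualAnnihilator]
      rintro _ ⟨w, rfl⟩
      rw [hΦ]
      have := mem_intertwiners.1 φ.2 w
      simp [this, hℓ']
    have h2 := (Nat.add_le_add_left (Submodule.finrank_mono hr) _).trans
      (Subspace.finrank_add_finrank_dualAnnihilator_eq
        (LinearMap.range (f - algebraMap k (End k W) c))).le
    have h4 := hg c
    let Ψ : LinearMap.ker Φ →ₗ[k] intertwiners f (f'.restrict hUf) :=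
      { toFun := fun φ => ⟨φ.1.1.codRestrict U fun w => by
            rw [hU, LinearMap.mem_ker, ← hΦ, LinearMap.mem_ker.1 φ.2]; rfl,
          mem_intertwiners.2 fun w => Subtype.ext (mem_intertwiners.1 φ.1.2 w)⟩
        map_add' := fun _ _ => rfl
        map_smul' := fun _ _ => rfl }
    have hΨ : Function.Injective Ψ := by
      intro φ φ' h
      apply Subtype.ext; apply Subtype.ext; ext w
      have := LinearMap.congr_fun (congrArg Subtype.val h) w
      exact congrArg Subtype.val this
    have h5 := LinearMap.finrank_le_finrank_of_injective hΨ
    rw [mul_add, mul_one]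
    omega

/-- Greedy choice: if every polynomial of degree below `r` had a linear factor lowering the rank by
more than `dim V / r`, then `r` such factors would lower it by more than `dim V`. -/
theorem exists_monic_rank_drop_le {V : Type*} [AddCommGroup V] [Module k V]
    [FiniteDimensional k V] (x : End k V) (r : ℕ) (hr : 0 < r) :
    ∃ p : k[X], p.Monic ∧ p.natDegree < r ∧ ∀ c : k,
      (finrank k (LinearMap.range (aeval x p)) -
        finrank k (LinearMap.range (aeval x ((X - C c) * p)))) * r ≤ finrank k V := by
  by_contra! hcon
  -- The extra summand `j` records that each of the `j` drops is strict; it makes `j = r`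
  -- contradictory.
  have key : ∀ j ≤ r, ∃ p : k[X], p.Monic ∧ p.natDegree = j ∧
      finrank k (LinearMap.range (aeval x p)) * r + j * finrank k V + j ≤ finrank k V * r := by
    intro j
    induction j with
    | zero =>
      refine fun _ => ⟨1, monic_one, natDegree_one, ?_⟩
      have := Submodule.finrank_le (LinearMap.range (aeval x (1 : k[X])))
      nlinarith
    | succ j ih =>
      intro hj
      obtain ⟨p, hp, hpd, hpr⟩ := ih (by omega)
      obtain ⟨c, hc⟩ := hcon p hp (by omega)
      refine ⟨(X - C c) * p, (monic_X_sub_C c).mul hp, ?_, ?_⟩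
      · rw [(monic_X_sub_C c).natDegree_mul hp, natDegree_X_sub_C, hpd, add_comm]
      · set A := finrank k (LinearMap.range (aeval x p))
        set B := finrank k (LinearMap.range (aeval x ((X - C c) * p)))
        have hAB : B ≤ A := by
          by_contra hlt
          rw [Nat.sub_eq_zero_of_le (by omega), zero_mul] at hc
          omega
        obtain ⟨D, hD⟩ := Nat.exists_eq_add_of_le hAB
        rw [hD, Nat.add_sub_cancel_left] at hc
        rw [hD] at hpr
        nlinarith
  obtain ⟨p, -, -, hp⟩ := key r le_rfl
  nlinarith

/-- For an operator `x` on a `d`-dimensional space there is a monic polynomial `p` of degree less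
than `r` such that the multiples of `p(x)` by operators commuting with `x` span a space of
dimension at most `d² / r`. -/
theorem exists_monic_finrank_mul_centralizer_le [IsAlgClosed k] {V : Type*} [AddCommGroup V]
    [Module k V] [FiniteDimensional k V] (x : End k V) (r : ℕ) (hr : 0 < r) :
    ∃ p : k[X], p.Monic ∧ p.natDegree < r ∧ ∀ S : Submodule k (End k V),
      (∀ s ∈ S, ∃ y : End k V, Commute y x ∧ s = y * aeval x p) →
      finrank k S * r ≤ finrank k V ^ 2 := by
  obtain ⟨p, hp, hpr, hdrop⟩ := exists_monic_rank_drop_le x r hr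
  refine ⟨p, hp, hpr, fun S hS => ?_⟩
  set q := aeval x p with hq
  set W := LinearMap.range q with hW
  have hxq : ∀ v, x (q v) = q (x v) := fun v => by
    have : x * q = q * x := by
      calc x * q = aeval x (X * p) := by rw [map_mul, aeval_X]
        _ = q * x := by rw [mul_comm, map_mul, aeval_X]
    exact LinearMap.congr_fun this v
  have hxW : ∀ w ∈ W, x w ∈ W := by
    rintro _ ⟨v, rfl⟩
    exact ⟨x v, (hxq v).symm⟩
  set f := x.restrict hxW with hf
  have hrange : ∀ c : k, finrank k (LinearMap.range (f - algebraMap k (End k W) c)) =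
      finrank k (LinearMap.range (aeval x ((X - C c) * p))) := by
    intro c
    have hmap : (LinearMap.range (f - algebraMap k (End k W) c)).map W.subtype =
        LinearMap.range (aeval x ((X - C c) * p)) := by
      have hcomp : ∀ v, (W.subtype ((f - algebraMap k (End k W) c) (q.rangeRestrict v))) =
          aeval x ((X - C c) * p) v := fun v => by
        simp [hf, hq, Module.End.mul_apply]
      ext v
      constructor
      · rintro ⟨_, ⟨⟨_, u, rfl⟩, rfl⟩, rfl⟩
        exact ⟨u, (hcomp u).symm⟩
      · rintro ⟨u, rfl⟩
        exact ⟨_, ⟨q.rangeRestrict u, rfl⟩, hcomp u⟩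
    rw [← hmap, Submodule.finrank_map_subtype_eq]
  set g := finrank k V / r with hg
  have hgr : g * r ≤ finrank k V := Nat.div_mul_le_self _ _
  have h1 := finrank_intertwiners_le f g (fun c => by
    rw [hrange]
    have := (Nat.le_div_iff_mul_le hr).2 (hdrop c)
    omega) x
  let Θ : (W →ₗ[k] V) →ₗ[k] End k V := LinearMap.lcomp k V q.rangeRestrict
  -- The operator `y * p(x)` depends only on `y` restricted to the range `W` of `p(x)`, and this
  -- restriction intertwines `x` on `W` with `x` on `V`.
  have h2 : S ≤ (intertwiners f x).map Θ := by
    intro s hs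
    obtain ⟨y, hy, rfl⟩ := hS s hs
    refine ⟨y.domRestrict W, mem_intertwiners.2 fun w => LinearMap.congr_fun hy w.1, ?_⟩
    rfl
  have h3 := (Submodule.finrank_mono h2).trans (Submodule.finrank_map_le Θ _)
  calc finrank k S * r ≤ (g * finrank k V) * r := by gcongr; exact h3.trans h1
    _ = (g * r) * finrank k V := by ring
    _ ≤ _ := by rw [sq]; gcongr

/-- Reducing each power of `x i` modulo `p i` shows that the monomials with exponents below the
degrees span `A`. -/
theorem finrank_le_prod_natDegree {A : Type*} [CommRing A] [Algebra k A] {ι : Type*} [Fintype ι]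
    (x : ι → A) (hx : Algebra.adjoin k (Set.range x) = ⊤) (p : ι → k[X])
    (hp : ∀ i, (p i).Monic) (h0 : ∀ i, aeval (x i) (p i) = 0) :
    finrank k A ≤ ∏ i, (p i).natDegree := by
  classical
  let mon : (∀ i, Fin (p i).natDegree) → A := fun e => ∏ i, x i ^ (e i : ℕ)
  have hspan : Submodule.span k (Set.range mon) = ⊤ := by
    rw [eq_top_iff]
    rintro a -
    have ha : a ∈ Algebra.adjoin k (Set.range x) := hx ▸ Algebra.mem_top
    rw [Algebra.adjoin_range_eq_range_aeval] at ha
    obtain ⟨Q, rfl⟩ := ha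
    change MvPolynomial.aeval x Q ∈ _
    rw [MvPolynomial.aeval_def, MvPolynomial.eval₂_eq']
    refine Submodule.sum_mem _ fun e _ => ?_
    rw [← Algebra.smul_def]
    refine Submodule.smul_mem _ _ ?_
    have hpow : ∀ i, x i ^ (e i) = ∑ j : Fin (p i).natDegree,
        (X ^ (e i) %ₘ p i).coeff j • x i ^ (j : ℕ) := by
      intro i
      have h1 : x i ^ e i = aeval (x i) (X ^ (e i) %ₘ p i) := by
        rw [aeval_modByMonic_eq_self_of_root (h0 i)]; simp
      have hlt : (X ^ (e i) %ₘ p i).degree < ((p i).natDegree : ℕ) := by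
        rw [← degree_eq_natDegree (hp i).ne_zero]
        exact degree_modByMonic_lt _ (hp i)
      rw [h1, aeval_def, eval₂_eq_sum, ← sum_fin _ (by simp) hlt]
      simp only [← Algebra.smul_def]
    have : ∏ i, x i ^ (e i) = ∑ f : (∀ i, Fin (p i).natDegree),
        (∏ i, (X ^ (e i) %ₘ p i).coeff (f i)) • mon f := by
      simp_rw [hpow]
      rw [Finset.prod_univ_sum, Fintype.piFinset_univ]
      refine Finset.sum_congr rfl fun f _ => ?_
      rw [Finset.prod_smul]
    rw [this]
    exact Submodule.sum_mem _ fun f _ => Submodule.smul_mem _ _ (Submodule.subset_span ⟨f, rfl⟩)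
  have := finrank_range_le_card (R := k) mon
  rw [Set.finrank, hspan, finrank_top] at this
  simpa using this

/-- Let `J` be generated by the `p i (x i)`. It is a sum of `l` principal ideals, each of dimension
at most `d ^ 2 / r` with `d = dim V`, and `R ⧸ J` has dimension at most `(r - 1) ^ l` since each `p
i` has degree at most `r - 1`. -/
theorem finrank_mul_le_of_injective_end [IsAlgClosed k] {R : Type*} [CommRing R] [Algebra k R]
    {V : Type*} [AddCommGroup V] [Module k V] [FiniteDimensional k V] (ψ : R →ₐ[k] End k V)
    (hψ : Function.Injective ψ) {l : ℕ} (x : Fin l → R)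
    (hx : Algebra.adjoin k (Set.range x) = ⊤) (r : ℕ) (hr : 0 < r) :
    finrank k R * r ≤ l * finrank k V ^ 2 + (r - 1) ^ l * r := by
  have hfin : FiniteDimensional k R := Module.Finite.of_injective ψ.toLinearMap hψ
  choose p hp hpr hS using fun i => exists_monic_finrank_mul_centralizer_le (ψ (x i)) r hr
  let q : Fin l → R := fun i => aeval (x i) (p i)
  let S : Fin l → Submodule k R := fun i => LinearMap.range (LinearMap.mulRight k (q i))
  have hSr : ∀ i, finrank k (S i) * r ≤ finrank k V ^ 2 := by
    intro i
    have h1 := hS i ((S i).map ψ.toLinearMap) (by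
      rintro _ ⟨_, ⟨y, rfl⟩, rfl⟩
      refine ⟨ψ y, ?_, ?_⟩
      · rw [Commute, SemiconjBy, ← map_mul, ← map_mul, mul_comm]
      · simp [q, aeval_algHom_apply])
    rwa [← (Submodule.equivMapOfInjective ψ.toLinearMap hψ (S i)).finrank_eq] at h1
  let J : Ideal R := Ideal.span (Set.range q)
  have hJ : finrank k (J.restrictScalars k) ≤ ∑ i, finrank k (S i) := by
    let σ : (∀ i, S i) →ₗ[k] R := ∑ i, (S i).subtype ∘ₗ LinearMap.proj i
    have hJσ : J.restrictScalars k ≤ LinearMap.range σ := by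
      intro a ha
      obtain ⟨c, hc⟩ := (Ideal.mem_span_range_iff_exists_fun).1 (show a ∈ J from ha)
      refine ⟨fun i => ⟨c i * q i, c i, rfl⟩, ?_⟩
      simpa [σ] using hc
    calc _ ≤ finrank k (LinearMap.range σ) := Submodule.finrank_mono hJσ
      _ ≤ finrank k (∀ i, S i) := LinearMap.finrank_range_le σ
      _ = _ := finrank_pi_fintype k
  have hquot : finrank k (R ⧸ J) ≤ (r - 1) ^ l := by
    have h1 := finrank_le_prod_natDegree (k := k) (fun i => Ideal.Quotient.mkₐ k J (x i)) (by
        rw [show (fun i => Ideal.Quotient.mkₐ k J (x i)) = Ideal.Quotient.mkₐ k J ∘ x from rfl,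
          Set.range_comp, ← AlgHom.map_adjoin, hx, Algebra.map_top,
          AlgHom.range_eq_top]
        exact Ideal.Quotient.mkₐ_surjective k J) p hp (fun i => by
        rw [aeval_algHom_apply]
        exact Ideal.Quotient.eq_zero_iff_mem.2 (Ideal.subset_span ⟨i, rfl⟩))
    refine h1.trans ((Finset.prod_le_prod' fun i _ => Nat.le_sub_one_of_lt (hpr i)).trans ?_)
    simp
  have htot : finrank k (R ⧸ J) + finrank k (J.restrictScalars k) = finrank k R :=
    (J.restrictScalars k).finrank_quotient_add_finrank
  calc finrank k R * r = finrank k (J.restrictScalars k) * r + finrank k (R ⧸ J) * r := by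
        rw [← htot]; ring
    _ ≤ (∑ i, finrank k (S i)) * r + (r - 1) ^ l * r := by gcongr
    _ ≤ _ := by
      refine Nat.add_le_add_right ?_ _
      rw [Finset.sum_mul]
      refine (Finset.sum_le_sum fun i _ => hSr i).trans ?_
      simp

/-- A commutative algebra of operators on a `d`-dimensional space that is generated by `l` elements
has dimension at most `(l + 1) t ^ l`, where `t ^ (l + 1) = d ^ 2`. -/
theorem finrank_le_of_injective_end [IsAlgClosed k] {R : Type*} [CommRing R] [Algebra k R]
    {V : Type*} [AddCommGroup V] [Module k V] [FiniteDimensional k V] (ψ : R →ₐ[k] End k V)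
    (hψ : Function.Injective ψ) {l : ℕ} (x : Fin l → R)
    (hx : Algebra.adjoin k (Set.range x) = ⊤) (t : ℝ) (ht : 0 < t)
    (htl : t ^ (l + 1) = (finrank k V : ℝ) ^ 2) :
    (finrank k R : ℝ) ≤ (l + 1) * t ^ l := by
  have hr0 : 0 < ⌈t⌉₊ := Nat.ceil_pos.2 ht
  -- With `r = ⌈t⌉₊` one has `r - 1 ≤ t ≤ r`, exactly what the two terms need: `d ^ 2 / r ≤ t ^ l`
  -- and `(r - 1) ^ l ≤ t ^ l`.
  have h := finrank_mul_le_of_injective_end ψ hψ x hx ⌈t⌉₊ hr0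
  set r := ⌈t⌉₊
  have hr : (0 : ℝ) < r := by exact_mod_cast hr0
  have h' : (finrank k R : ℝ) * r ≤ l * t ^ (l + 1) + ((r : ℝ) - 1) ^ l * r := by
    rw [htl]
    have : ((r - 1 : ℕ) : ℝ) = (r : ℝ) - 1 := by
      rw [Nat.cast_sub hr0, Nat.cast_one]
    rw [← this]
    exact_mod_cast h
  have htr : t ≤ r := Nat.le_ceil t
  have hrt : (r : ℝ) - 1 ≤ t := by
    have := Nat.ceil_lt_add_one ht.le
    simp only [r]; linarith
  have hr1 : (0 : ℝ) ≤ (r : ℝ) - 1 := by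
    have : (1 : ℝ) ≤ r := by exact_mod_cast hr0
    linarith
  refine le_of_mul_le_mul_right (h'.trans ?_) hr
  have h1 : ((r : ℝ) - 1) ^ l ≤ t ^ l := pow_le_pow_left₀ hr1 hrt l
  have h2 : (l : ℝ) * t ^ (l + 1) ≤ l * t ^ l * r := by
    rw [pow_succ, ← mul_assoc]; gcongr
  nlinarith [mul_le_mul_of_nonneg_right h1 hr.le]

open scoped IsMulCommutative in
theorem finrank_adjoin_range_le [IsAlgClosed k] {V : Type*} [AddCommGroup V] [Module k V]
    [FiniteDimensional k V] {l : ℕ} (x : Fin l → End k V) (hx : ∀ i j, x i * x j = x j * x i)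
    (t : ℝ) (ht : 0 < t) (htl : t ^ (l + 1) = (finrank k V : ℝ) ^ 2) :
    (finrank k (Algebra.adjoin k (Set.range x)) : ℝ) ≤ (l + 1) * t ^ l := by
  have : IsMulCommutative (Algebra.adjoin k (Set.range x)) := Algebra.isMulCommutative_adjoin k (by
    rintro _ ⟨i, rfl⟩ _ ⟨j, rfl⟩
    exact hx i j)
  refine finrank_le_of_injective_end (Algebra.adjoin k (Set.range x)).val
    Subtype.val_injective (fun i => ⟨x i, Algebra.subset_adjoin ⟨i, rfl⟩⟩) ?_ t ht htl
  rw [eq_top_iff, ← Algebra.adjoin_adjoin_coe_preimage]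
  refine Algebra.adjoin_mono ?_
  rintro ⟨_, h⟩ ⟨i, rfl⟩
  exact ⟨i, rfl⟩

/-- **Burnside's theorem**: a subalgebra of operators acting transitively on nonzero vectors is
the whole algebra. -/
theorem subalgebra_eq_top_of_transitive [IsAlgClosed k] {V : Type*} [AddCommGroup V] [Module k V]
    [FiniteDimensional k V] (S : Subalgebra k (End k V))
    (hS : ∀ v : V, v ≠ 0 → ∀ w, ∃ s ∈ S, s v = w) : S = ⊤ := by
  classical
  rcases subsingleton_or_nontrivial V with hV | hV
  · rw [eq_top_iff]
    rintro f -
    rw [Subsingleton.elim f 0]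
    exact S.zero_mem
  have hsimple : IsSimpleModule S V := by
    rw [isSimpleModule_iff_toSpanSingleton_surjective]
    refine ⟨hV, fun v hv w => ?_⟩
    obtain ⟨s, hs, h⟩ := hS v hv w
    exact ⟨⟨s, hs⟩, h⟩
  have hschur := (IsSimpleModule.algebraMap_end_bijective_of_isAlgClosed k (A := S) (V := V)).2
  rw [eq_top_iff]
  rintro f -
  -- By Schur, `End S V` consists of scalars, so any `k`-linear `f` commutes with it, and Jacobson
  -- density matches `f` with an element of `S` on a basis.
  let F : End (End S V) V :=
    { toFun := f
      map_add' := f.map_add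
      map_smul' := fun φ v => by
        obtain ⟨c, rfl⟩ := hschur φ
        exact f.map_smul c v }
  obtain ⟨s, hs⟩ := jacobson_density F (Finset.univ.image (Module.finBasis k V))
  have : f = s.1 := (Module.finBasis k V).ext fun i => hs _ (by simp)
  rw [this]
  exact s.2

end LinearAlgebra

/-! ### Topology and block factorization of congruence subgroups. -/

section MatrixGroups

theorem finiteIndex_subgroupOf_of_isOpen {G : Type*} [Group G] [TopologicalSpace G]
    [IsTopologicalGroup G] {K N : Subgroup G} (hK : IsCompact (K : Set G))
    (hN : IsOpen (N : Set G)) : (N.subgroupOf K).FiniteIndex := by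
  have : CompactSpace K := isCompact_iff_compactSpace.1 hK
  have hopen : IsOpen ((N.subgroupOf K : Subgroup K) : Set K) :=
    hN.preimage continuous_subtype_val
  have := Subgroup.quotient_finite_of_isOpen (N.subgroupOf K) hopen
  exact Subgroup.finiteIndex_of_finite_quotient

variable {F : Type*} [NontriviallyNormedField F] [IsUltrametricDist F] {n : ℕ}

theorem mem_integralGL_iff {g : GL (Fin n) F} :
    g ∈ integralGL F n ↔ (∀ i j, ‖g.1 i j‖ ≤ 1) ∧ ∀ i j, ‖g⁻¹.1 i j‖ ≤ 1 := by
  constructor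
  · rintro ⟨h, rfl⟩
    exact ⟨fun i j => (h.1 i j).2, fun i j => by
      rw [← map_inv]
      exact (h⁻¹.1 i j).2⟩
  · rintro ⟨h1, h2⟩
    have hinj : Function.Injective ((algebraMap (integers F) F).mapMatrix (m := Fin n)) := by
      intro A B h
      ext i j
      exact congrFun (congrFun h i) j
    let A : Matrix (Fin n) (Fin n) (integers F) := Matrix.of fun i j => ⟨g.1 i j, h1 i j⟩
    let B : Matrix (Fin n) (Fin n) (integers F) := Matrix.of fun i j => ⟨g⁻¹.1 i j, h2 i j⟩
    refine ⟨⟨A, B, hinj ?_, hinj ?_⟩, Units.ext rfl⟩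
    · rw [map_mul, map_one]
      exact Units.mul_inv g
    · rw [map_mul, map_one]
      exact Units.inv_mul g

variable {ϖ : integers F} (hϖ : IsUniformizer ϖ) {m : ℕ} (hm : 1 ≤ m)

theorem IsUniformizer.norm_le {ϖ : integers F} (hϖ : IsUniformizer ϖ) {x : F} (hx : ‖x‖ < 1) :
    ‖x‖ ≤ ‖(ϖ : F)‖ := by
  have h1 : (⟨x, hx.le⟩ : integers F) ∈ IsLocalRing.maximalIdeal (integers F) :=
    (Valuation.mem_maximalIdeal_iff (v := NormedField.valuation (K := F))).2 hx
  rw [hϖ, Ideal.mem_span_singleton] at h1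
  obtain ⟨y, hy⟩ := h1
  have hy' : x = ϖ * y := congrArg Subtype.val hy
  rw [hy', norm_mul]
  exact mul_le_of_le_one_right (norm_nonneg _) y.2

theorem IsUniformizer.norm_pos {ϖ : integers F} (hϖ : IsUniformizer ϖ) : 0 < ‖(ϖ : F)‖ := by
  obtain ⟨x, hx0, hx1⟩ := NormedField.exists_norm_lt_one F
  exact hx0.trans_le (hϖ.norm_le hx1)

/-- Trap `‖x‖` between consecutive powers of `‖ϖ‖`; a value strictly between them would rescale to a
norm strictly between `‖ϖ‖` and `1`, against `IsUniformizer.norm_le`. -/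
theorem IsUniformizer.exists_norm_eq_zpow {ϖ : integers F} (hϖ : IsUniformizer ϖ) {x : F}
    (hx : x ≠ 0) : ∃ e : ℤ, ‖x‖ = ‖(ϖ : F)‖ ^ e := by
  obtain ⟨e, he1, he2⟩ := exists_mem_Ioc_zpow (norm_pos_iff.2 hx)
    ((one_lt_inv₀ hϖ.norm_pos).2 hϖ.norm_lt_one)
  refine ⟨-(e + 1), le_antisymm ?_ ?_⟩
  · rwa [zpow_neg, ← inv_zpow]
  · by_contra! hlt
    have hϖ0 : (ϖ : F) ≠ 0 := norm_pos_iff.1 hϖ.norm_pos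
    have h1 : ‖x * (ϖ : F) ^ (e + 1)‖ < 1 := by
      rw [norm_mul, norm_zpow]
      calc _ < ‖(ϖ : F)‖ ^ (-(e + 1)) * ‖(ϖ : F)‖ ^ (e + 1) :=
            mul_lt_mul_of_pos_right hlt (zpow_pos hϖ.norm_pos _)
        _ = 1 := by rw [← zpow_add₀ hϖ.norm_pos.ne', neg_add_cancel, zpow_zero]
    have h2 := hϖ.norm_le h1
    rw [norm_mul, norm_zpow, zpow_add_one₀ hϖ.norm_pos.ne', ← mul_assoc] at h2
    have h3 : ‖x‖ * ‖(ϖ : F)‖ ^ e ≤ 1 := by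
      have := hϖ.norm_pos
      nlinarith
    rw [inv_zpow, inv_lt_iff_one_lt_mul₀ (zpow_pos hϖ.norm_pos _), mul_comm] at he1
    linarith

theorem congruenceSubgroup_le_integralGL :
    congruenceSubgroup n hϖ m hm ≤ integralGL F n := by
  have hc1 : ‖(ϖ : F)‖ ^ m < 1 := pow_lt_one₀ (norm_nonneg _) hϖ.norm_lt_one (by omega)
  intro x hx
  have hinv := fun y hy => inv_entry_le (F := F) (n := n) (by positivity) hc1 y hy
  refine mem_integralGL_iff.2 ⟨fun i j => ?_, hinv x hx⟩
  simpa using hinv x⁻¹ ((congruenceSubgroup n hϖ m hm).inv_mem hx) i j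

theorem conj_mem_congruenceSubgroup {g x : GL (Fin n) F} (hg : g ∈ integralGL F n)
    (hx : x ∈ congruenceSubgroup n hϖ m hm) : g * x * g⁻¹ ∈ congruenceSubgroup n hϖ m hm := by
  intro i j
  have e : 1 - (g * x * g⁻¹ : GL (Fin n) F).1 = g.1 * (1 - x.1) * g⁻¹.1 := by
    rw [mul_sub, sub_mul, mul_one, ← Units.val_mul, ← Units.val_mul, ← Units.val_mul,
      mul_inv_cancel, Units.val_one]
  rw [e]
  obtain ⟨h1, h2⟩ := mem_integralGL_iff.1 hg
  simpa using mul_entry_le (by positivity) zero_le_one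
    (mul_entry_le zero_le_one (by positivity) h1 hx) h2 i j

theorem isOpen_congruenceSubgroup : IsOpen (congruenceSubgroup n hϖ m hm : Set (GL (Fin n) F)) := by
  have : (congruenceSubgroup n hϖ m hm : Set (GL (Fin n) F)) = ⋂ i, ⋂ j,
      (fun x : GL (Fin n) F => (1 - x.1) i j) ⁻¹' Metric.closedBall 0 (‖(ϖ : F)‖ ^ m) := by
    ext x
    simp only [Set.mem_iInter, Set.mem_preimage, mem_closedBall_zero_iff]
    rfl
  rw [this]
  refine isOpen_iInter_of_finite fun i => isOpen_iInter_of_finite fun j => ?_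
  refine (IsUltrametricDist.isOpen_closedBall _ (pow_pos hϖ.norm_pos m).ne').preimage ?_
  exact (continuous_const.sub Units.continuous_val).matrix_elem i j

/-- Under the closed embedding `g ↦ (g, g⁻¹)` the group is the preimage of a product of closed unit
balls, compact because `F` is proper. -/
theorem isCompact_integralGL [LocallyCompactSpace F] :
    IsCompact (integralGL F n : Set (GL (Fin n) F)) := by
  have : ProperSpace F := ProperSpace.of_nontriviallyNormedField_of_weaklyLocallyCompactSpace F
  let B : Set (Matrix (Fin n) (Fin n) F) :=
    Set.univ.pi fun _ => Set.univ.pi fun _ => Metric.closedBall 0 1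
  have hB : IsCompact B :=
    isCompact_univ_pi fun _ => isCompact_univ_pi fun _ => isCompact_closedBall 0 1
  have hBB : IsCompact (B ×ˢ (MulOpposite.unop ⁻¹' B)) :=
    hB.prod ((MulOpposite.opHomeomorph.symm.isClosedEmbedding).isCompact_preimage hB)
  have hc := (Units.isClosedEmbedding_embedProduct (α := Matrix (Fin n) (Fin n) F)).isCompact_preimage
    hBB
  convert hc using 1
  ext g
  rw [SetLike.mem_coe, mem_integralGL_iff]
  constructor
  · rintro ⟨h1, h2⟩
    exact ⟨fun i _ j _ => mem_closedBall_zero_iff.2 (h1 i j),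
      fun i _ j _ => mem_closedBall_zero_iff.2 (h2 i j)⟩
  · rintro ⟨h1, h2⟩
    exact ⟨fun i j => mem_closedBall_zero_iff.1 (h1 i trivial j trivial),
      fun i j => mem_closedBall_zero_iff.1 (h2 i trivial j trivial)⟩

theorem isCompact_congruenceSubgroup [LocallyCompactSpace F] :
    IsCompact (congruenceSubgroup n hϖ m hm : Set (GL (Fin n) F)) :=
  isCompact_integralGL.of_isClosed_subset
    (Subgroup.isClosed_of_isOpen _ (isOpen_congruenceSubgroup hϖ hm))
    (congruenceSubgroup_le_integralGL hϖ hm)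

/-- A kernel vector of `A` is fixed by `1 - A`, which shrinks its largest coordinate. -/
theorem det_ne_zero_of_norm_one_sub_le {c : ℝ} (hc : c < 1) {A : Matrix (Fin n) (Fin n) F}
    (hA : ∀ i j, ‖(1 - A) i j‖ ≤ c) : A.det ≠ 0 := by
  intro h0
  obtain ⟨v, hv, hAv⟩ := Matrix.exists_mulVec_eq_zero_iff.2 h0
  have hv' : v = (1 - A).mulVec v := by rw [Matrix.sub_mulVec, hAv, Matrix.one_mulVec, sub_zero]
  obtain ⟨i0, hi0⟩ := Function.ne_iff.1 hv
  obtain ⟨p, -, hp⟩ := Finset.exists_max_image Finset.univ (fun i => ‖v i‖) ⟨i0, Finset.mem_univ _⟩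
  have hpos : 0 < ‖v p‖ := (norm_pos_iff.2 hi0).trans_le (hp i0 (Finset.mem_univ _))
  have hc0 : 0 ≤ c := (norm_nonneg _).trans (hA p p)
  have h1 : ‖v p‖ ≤ c * ‖v p‖ := by
    have hvp : v p = ∑ j, (1 - A) p j * v j := congrFun hv' p
    refine (congrArg norm hvp).le.trans ?_
    refine IsUltrametricDist.norm_sum_le_of_forall_le_of_nonneg (mul_nonneg hc0 hpos.le) fun j _ => ?_
    rw [norm_mul]
    exact mul_le_mul (hA p j) (hp j (Finset.mem_univ _)) (norm_nonneg _) hc0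
  nlinarith

/-- Factorization of a congruence subgroup along a two-block decomposition of the indices. -/
theorem exists_block_factorization (s : Fin n → Prop) {x : GL (Fin n) F}
    (hx : x ∈ congruenceSubgroup n hϖ m hm) :
    ∃ y ∈ congruenceSubgroup n hϖ m hm, ∃ z ∈ congruenceSubgroup n hϖ m hm, x = y * z ∧
      (∀ i j, ¬ (¬ s i ∧ s j) → (1 - y.1) i j = 0) ∧ ∀ i j, ¬ s i → s j → z.1 i j = 0 := by
  classical
  have hc1 : ‖(ϖ : F)‖ ^ m < 1 := pow_lt_one₀ (norm_nonneg _) hϖ.norm_lt_one (by omega)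
  -- Block LU elimination: `p` projects onto the `s`-coordinates, and `A` is the `s`-block of `x`
  -- extended by the identity, invertible since `1 - A = p (1 - x) p` is small.
  let p : Matrix (Fin n) (Fin n) F := Matrix.diagonal fun i => if s i then 1 else 0
  have hpp : p * p = p := by
    simp only [p, Matrix.diagonal_mul_diagonal]
    congr 1; ext i; split_ifs <;> simp
  have hq : 1 - p = Matrix.diagonal fun i => if s i then (0 : F) else 1 := by
    rw [← Matrix.diagonal_one, Matrix.diagonal_sub]
    congr 1; ext i; split_ifs <;> simp
  let A : Matrix (Fin n) (Fin n) F := p * x.1 * p + (1 - p)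
  have hA : ∀ i j, ‖(1 - A) i j‖ ≤ ‖(ϖ : F)‖ ^ m := by
    intro i j
    have e : 1 - A = p * (1 - x.1) * p := by
      simp only [A, mul_sub, sub_mul, mul_one, hpp]; abel
    rw [e]
    simp only [p, Matrix.mul_diagonal, Matrix.diagonal_mul]
    split_ifs
    · simpa using hx i j
    all_goals simp
  let a : GL (Fin n) F := Matrix.GeneralLinearGroup.mkOfDetNeZero A
    (det_ne_zero_of_norm_one_sub_le hc1 hA)
  have ha1 : a.1 * a⁻¹.1 = 1 := Units.mul_inv a
  have ha2 : a⁻¹.1 * a.1 = 1 := Units.inv_mul a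
  have haA : a.1 = A := rfl
  have hinv : ∀ i j, ‖a⁻¹.1 i j‖ ≤ 1 := inv_entry_le (by positivity) hc1 a hA
  have hpA : p * A = A * p := by
    simp only [A, mul_add, add_mul, mul_sub, sub_mul, mul_one, one_mul, ← mul_assoc, hpp]
    rw [mul_assoc (p * x.1) p p, hpp]
  have hpa : p * a⁻¹.1 = a⁻¹.1 * p := by
    calc p * a⁻¹.1 = a⁻¹.1 * (A * p) * a⁻¹.1 := by rw [← mul_assoc, ← haA, ha2, one_mul]
      _ = _ := by rw [← hpA, mul_assoc, mul_assoc, ← haA, ha1, mul_one]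
  -- The off-diagonal block times the inverse of the `s`-block, so that `(1 - N) * x` loses this
  -- off-diagonal block. As `N * N = 0`, the inverse of `1 + N` is `1 - N`.
  let N : Matrix (Fin n) (Fin n) F := (1 - p) * x.1 * p * a⁻¹.1
  have hNp : N = N * p := by
    simp only [N]
    rw [mul_assoc _ (a⁻¹.1) p, ← hpa, ← mul_assoc, mul_assoc _ p p, hpp]
  have hNq : N = (1 - p) * N := by
    simp only [N, ← mul_assoc, mul_sub, sub_mul, one_mul, hpp]; simp
  have hpq : p * (1 - p) = 0 := by rw [mul_sub, hpp, mul_one, sub_self]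
  have hNN : N * N = 0 := by
    calc N * N = N * p * ((1 - p) * N) := by rw [← hNp, ← hNq]
      _ = N * (p * (1 - p)) * N := by simp only [mul_assoc]
      _ = 0 := by rw [hpq]; simp
  let y : GL (Fin n) F := ⟨1 + N, 1 - N, by
    rw [add_mul, one_mul, mul_sub, hNN, mul_one]; abel, by
    rw [sub_mul, one_mul, mul_add, hNN, mul_one]; abel⟩
  have hNs : ∀ i j, ¬ (¬ s i ∧ s j) → N i j = 0 := by
    intro i j hij
    rw [hNq, hNp, hq]
    simp only [p, Matrix.mul_diagonal, Matrix.diagonal_mul]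
    by_cases hi : s i
    · simp [hi]
    · have hj : ¬ s j := fun hj => hij ⟨hi, hj⟩
      simp [hj]
  have hNm : ∀ i j, ‖N i j‖ ≤ ‖(ϖ : F)‖ ^ m := by
    intro i j
    have e : N = -((1 - p) * (1 - x.1) * p * a⁻¹.1) := by
      simp only [N, mul_sub, sub_mul, one_mul, mul_one, hpp]; simp
    have hp1 : ∀ i j, ‖p i j‖ ≤ 1 := fun i j => by
      simp only [p, Matrix.diagonal_apply]; split_ifs <;> simp
    have hq1 : ∀ i j, ‖(1 - p) i j‖ ≤ 1 := fun i j => by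
      rw [Matrix.sub_apply, sub_eq_add_neg]
      exact add_entry_le (one_entry_le i j) (by rw [norm_neg]; exact hp1 i j)
    rw [e, Matrix.neg_apply, norm_neg]
    simpa using mul_entry_le (by positivity) zero_le_one (mul_entry_le (by positivity) zero_le_one
      (mul_entry_le zero_le_one (by positivity) hq1 hx) hp1) hinv i j
  have hyN : 1 - y.1 = -N := by simp [y]
  have hy : y ∈ congruenceSubgroup n hϖ m hm := fun i j => by
    rw [hyN, Matrix.neg_apply, norm_neg]; exact hNm i j
  refine ⟨y, hy, y⁻¹ * x, mul_mem (inv_mem hy) hx, by group, fun i j hij => ?_,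
    fun i j hi hj => ?_⟩
  · rw [hyN, Matrix.neg_apply, hNs i j hij, neg_zero]
  · have e : (1 - p) * ((y⁻¹ * x : GL (Fin n) F).1 * p) = 0 := by
      have e1 : (y⁻¹ * x : GL (Fin n) F).1 = (1 - N) * x.1 := rfl
      have e2 : p * x.1 * p = A * p := by
        simp only [A, add_mul, mul_assoc, hpp, sub_mul, one_mul]; simp
      have e3 : N * x.1 * p = (1 - p) * x.1 * p := by
        calc N * x.1 * p = (1 - p) * x.1 * (p * a⁻¹.1) * p * x.1 * p := by
              rw [hNp]; simp only [N, mul_assoc]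
          _ = (1 - p) * x.1 * (a⁻¹.1 * p) * p * x.1 * p := by rw [hpa]
          _ = (1 - p) * x.1 * a⁻¹.1 * (p * x.1 * p) := by
              rw [← mul_assoc _ (a⁻¹.1) p, mul_assoc _ p p, hpp]; simp only [mul_assoc]
          _ = (1 - p) * x.1 * (a⁻¹.1 * a.1) * p := by rw [e2, haA]; simp only [mul_assoc]
          _ = _ := by rw [ha2, mul_one]
      have e4 : (1 - N) * x.1 * p = x.1 * p - (1 - p) * x.1 * p := by
        rw [sub_mul, sub_mul, one_mul, e3]
      have hqq : (1 - p) * (1 - p) = 1 - p := by rw [sub_mul, hpq, one_mul, sub_zero]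
      rw [e1, e4, mul_sub (1 - p), mul_assoc (1 - p) x.1 p, ← mul_assoc (1 - p) (1 - p), hqq,
        sub_self]
    have h := congrFun (congrFun e i) j
    rw [hq] at h
    simpa [p, Matrix.mul_diagonal, Matrix.diagonal_mul, hi, hj] using h

end MatrixGroups

/-! ### Cartan decomposition and the lower bound `n !` for the index. -/

section Cartan

variable {F : Type*} [NontriviallyNormedField F] {n : ℕ}

/-- The diagonal torus of `GL_n`. -/
def diagGL (F : Type*) [Field F] (n : ℕ) : (Fin n → Fˣ) →* GL (Fin n) F where
  toFun d := ⟨Matrix.diagonal fun i => (d i : F), Matrix.diagonal fun i => ((d i)⁻¹ : Fˣ),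
    by simp [Matrix.diagonal_mul_diagonal], by simp [Matrix.diagonal_mul_diagonal]⟩
  map_one' := Units.ext (by simp)
  map_mul' a b := Units.ext (by simp [Matrix.diagonal_mul_diagonal])

theorem diagGL_val (d : Fin n → Fˣ) : (diagGL F n d).1 = Matrix.diagonal fun i => (d i : F) := rfl

theorem diagGL_conj_apply (d : Fin n → Fˣ) (g : GL (Fin n) F) (i j : Fin n) :
    (diagGL F n d * g * (diagGL F n d)⁻¹).1 i j = d i * g.1 i j * (d j : F)⁻¹ := by
  rw [← map_inv, Units.val_mul, Units.val_mul, diagGL_val, diagGL_val, Matrix.mul_diagonal,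
    Matrix.diagonal_mul]
  simp

/-- The permutation matrix of `σ` as an element of `GL_n`. -/
def permGL (F : Type*) [Field F] {n : ℕ} (σ : Equiv.Perm (Fin n)) : GL (Fin n) F :=
  ⟨σ.permMatrix F, (σ⁻¹).permMatrix F, by rw [← Matrix.permMatrix_mul]; simp,
    by rw [← Matrix.permMatrix_mul]; simp⟩

/-- The block matrix with corner `a`, first row `r`, first column `c` and remaining block `M`. -/
def borderMatrix (a : F) (r c : Fin n → F) (M : Matrix (Fin n) (Fin n) F) :
    Matrix (Fin (n + 1)) (Fin (n + 1)) F :=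
  Matrix.of fun i j => Fin.cases (Fin.cases a r j) (fun i => Fin.cases (c i) (M i) j) i

open Matrix in
theorem borderMatrix_mul (a a' : F) (r c r' c' : Fin n → F) (M M' : Matrix (Fin n) (Fin n) F) :
    borderMatrix a r c M * borderMatrix a' r' c' M' =
      borderMatrix (a * a' + r ⬝ᵥ c') (a • r' + r ᵥ* M') (a' • c + M *ᵥ c')
        (vecMulVec c r' + M * M') := by
  ext i j
  rw [Matrix.mul_apply, Fin.sum_univ_succ]
  refine Fin.cases ?_ (fun i => ?_) i <;> refine Fin.cases ?_ (fun j => ?_) j <;>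
    simp [borderMatrix, dotProduct, vecMul, mulVec, vecMulVec_apply, Matrix.mul_apply, mul_comm]

theorem borderMatrix_one : borderMatrix (1 : F) 0 0 (1 : Matrix (Fin n) (Fin n) F) = 1 := by
  ext i j
  refine Fin.cases ?_ (fun i => ?_) i <;> refine Fin.cases ?_ (fun j => ?_) j <;>
    simp [borderMatrix, Matrix.one_apply, Fin.succ_ne_zero, (Fin.succ_ne_zero _).symm]

theorem eq_borderMatrix {F : Type*} (A : Matrix (Fin (n + 1)) (Fin (n + 1)) F) :
    A = borderMatrix (A 0 0) (fun j => A 0 j.succ) (fun i => A i.succ 0)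
      (Matrix.of fun i j => A i.succ j.succ) := by
  ext i j
  refine Fin.cases ?_ (fun i => ?_) i <;> refine Fin.cases ?_ (fun j => ?_) j <;>
    simp [borderMatrix]

theorem norm_borderMatrix_le {a : F} {r c : Fin n → F} {M : Matrix (Fin n) (Fin n) F} {b : ℝ}
    (ha : ‖a‖ ≤ b) (hr : ∀ j, ‖r j‖ ≤ b) (hc : ∀ i, ‖c i‖ ≤ b) (hM : ∀ i j, ‖M i j‖ ≤ b)
    (i j : Fin (n + 1)) : ‖borderMatrix a r c M i j‖ ≤ b := by
  refine Fin.cases ?_ (fun i => ?_) i <;> refine Fin.cases ?_ (fun j => ?_) j <;>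
    simp [borderMatrix, ha, hr, hc, hM]

/-- `1 ⊕ g` as an element of `GL_{n+1}`. -/
def oneSumGL (g : GL (Fin n) F) : GL (Fin (n + 1)) F :=
  ⟨borderMatrix 1 0 0 g.1, borderMatrix 1 0 0 g⁻¹.1,
    by rw [borderMatrix_mul, Units.mul_inv]; simp [borderMatrix_one],
    by rw [borderMatrix_mul, Units.inv_mul]; simp [borderMatrix_one]⟩

/-- The unipotent matrix with first row `(1, r)`. -/
def rowGL (r : Fin n → F) : GL (Fin (n + 1)) F :=
  ⟨borderMatrix 1 r 0 1, borderMatrix 1 (-r) 0 1, by simp [borderMatrix_mul, borderMatrix_one],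
    by simp [borderMatrix_mul, borderMatrix_one]⟩

/-- The unipotent matrix with first column `(1, c)`. -/
def colGL (c : Fin n → F) : GL (Fin (n + 1)) F :=
  ⟨borderMatrix 1 0 c 1, borderMatrix 1 0 (-c) 1, by simp [borderMatrix_mul, borderMatrix_one],
    by simp [borderMatrix_mul, borderMatrix_one]⟩

variable [IsUltrametricDist F]

theorem permGL_mem (σ : Equiv.Perm (Fin n)) : permGL F σ ∈ integralGL F n := by
  have h : ∀ (τ : Equiv.Perm (Fin n)) i j, ‖τ.permMatrix F i j‖ ≤ 1 := fun τ i j => by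
    rw [Equiv.Perm.permMatrix, PEquiv.toMatrix_apply]; split_ifs <;> simp
  exact mem_integralGL_iff.2 ⟨h σ, h σ⁻¹⟩

theorem oneSumGL_mem {g : GL (Fin n) F} (hg : g ∈ integralGL F n) :
    oneSumGL g ∈ integralGL F (n + 1) := by
  obtain ⟨h1, h2⟩ := mem_integralGL_iff.1 hg
  rw [mem_integralGL_iff]
  change (∀ i j, ‖borderMatrix 1 0 0 g.1 i j‖ ≤ 1) ∧ ∀ i j, ‖borderMatrix 1 0 0 g⁻¹.1 i j‖ ≤ 1
  exact ⟨norm_borderMatrix_le (by simp) (by simp) (by simp) h1,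
    norm_borderMatrix_le (by simp) (by simp) (by simp) h2⟩

theorem rowGL_mem {r : Fin n → F} (hr : ∀ i, ‖r i‖ ≤ 1) : rowGL r ∈ integralGL F (n + 1) := by
  rw [mem_integralGL_iff]
  change (∀ i j, ‖borderMatrix 1 r 0 1 i j‖ ≤ 1) ∧ ∀ i j, ‖borderMatrix 1 (-r) 0 1 i j‖ ≤ 1
  exact ⟨norm_borderMatrix_le (by simp) hr (by simp) one_entry_le,
    norm_borderMatrix_le (by simp) (by simpa using hr) (by simp) one_entry_le⟩

theorem colGL_mem {c : Fin n → F} (hc : ∀ i, ‖c i‖ ≤ 1) : colGL c ∈ integralGL F (n + 1) := by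
  rw [mem_integralGL_iff]
  change (∀ i j, ‖borderMatrix 1 0 c 1 i j‖ ≤ 1) ∧ ∀ i j, ‖borderMatrix 1 0 (-c) 1 i j‖ ≤ 1
  exact ⟨norm_borderMatrix_le (by simp) (by simp) hc one_entry_le,
    norm_borderMatrix_le (by simp) (by simp) (by simpa using hc) one_entry_le⟩

/-- **Cartan decomposition** for matrices over a non-archimedean field. -/
theorem exists_integralGL_mul_mul_eq_diagonal :
    ∀ (n : ℕ) (A : Matrix (Fin n) (Fin n) F), ∃ P ∈ integralGL F n, ∃ Q ∈ integralGL F n,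
      ∃ d : Fin n → F, (∀ i j, i ≤ j → ‖d j‖ ≤ ‖d i‖) ∧ P.1 * A * Q.1 = Matrix.diagonal d
  | 0, A => ⟨1, one_mem _, 1, one_mem _, 0, fun i => i.elim0, by ext i; exact i.elim0⟩
  | n + 1, A => by
    -- Pivoting on an entry of maximal norm makes the elimination multipliers integral and keeps the
    -- remaining block bounded by the pivot, whence the decreasing order of the diagonal.
    obtain ⟨p, -, hp⟩ := Finset.exists_max_image Finset.univ
      (fun p : Fin (n + 1) × Fin (n + 1) => ‖A p.1 p.2‖) ⟨(0, 0), Finset.mem_univ _⟩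
    obtain ⟨B, hB⟩ : ∃ B, B = (permGL F (Equiv.swap 0 p.1)).1 * A *
      (permGL F (Equiv.swap 0 p.2)).1 := ⟨_, rfl⟩
    have hBA : ∀ i j, B i j = A (Equiv.swap 0 p.1 i) (Equiv.swap 0 p.2 j) := fun i j => by
      rw [hB]
      simp [permGL, PEquiv.toMatrix_toPEquiv_mul, PEquiv.mul_toMatrix_toPEquiv]
    have hB0 : ∀ i j, ‖B i j‖ ≤ ‖B 0 0‖ := fun i j => by
      rw [hBA, hBA, Equiv.swap_apply_left, Equiv.swap_apply_left]
      exact hp (_, _) (Finset.mem_univ _)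
    by_cases h0 : B 0 0 = 0
    · refine ⟨_, permGL_mem (Equiv.swap 0 p.1), _, permGL_mem (Equiv.swap 0 p.2), 0, by simp, ?_⟩
      rw [← hB]
      ext i j
      have := hB0 i j
      rw [h0, norm_zero, norm_le_zero_iff] at this
      simp [this]
    let c : Fin n → F := fun i => -(B i.succ 0 / B 0 0)
    let r : Fin n → F := fun j => -(B 0 j.succ / B 0 0)
    let M : Matrix (Fin n) (Fin n) F :=
      fun i j => B i.succ j.succ - B i.succ 0 * B 0 j.succ / B 0 0
    have hpos : 0 < ‖B 0 0‖ := norm_pos_iff.2 h0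
    have hc : ∀ i, ‖c i‖ ≤ 1 := fun i => by
      simp only [c, norm_neg, norm_div]; exact div_le_one_of_le₀ (hB0 _ _) hpos.le
    have hr : ∀ i, ‖r i‖ ≤ 1 := fun i => by
      simp only [r, norm_neg, norm_div]; exact div_le_one_of_le₀ (hB0 _ _) hpos.le
    have hM : ∀ i j, ‖M i j‖ ≤ ‖B 0 0‖ := fun i j => by
      simp only [M]
      rw [sub_eq_add_neg]
      refine add_entry_le (hB0 _ _) ?_
      rw [norm_neg, norm_div, norm_mul, div_le_iff₀ hpos]
      exact mul_le_mul (hB0 _ _) (hB0 _ _) (norm_nonneg _) hpos.le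
    have hclear : (colGL c).1 * B * (rowGL r).1 = borderMatrix (B 0 0) 0 0 M := by
      have hc0 : B 0 0 • c + (fun i => B i.succ 0) = 0 := by
        ext i; simp only [c, Pi.add_apply, Pi.smul_apply, smul_eq_mul, Pi.zero_apply]
        field_simp; ring
      have hr0 : B 0 0 • r + (fun j => B 0 j.succ) = 0 := by
        ext i; simp only [r, Pi.add_apply, Pi.smul_apply, smul_eq_mul, Pi.zero_apply]
        field_simp; ring
      have hM0 : Matrix.vecMulVec c (fun j => B 0 j.succ) +
          (Matrix.of fun i j : Fin n => B i.succ j.succ) = M := by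
        ext i j
        simp only [Matrix.add_apply, Matrix.vecMulVec_apply, Matrix.of_apply, c, M]
        ring
      conv_lhs => rw [eq_borderMatrix B]
      simp only [colGL, rowGL]
      rw [borderMatrix_mul, borderMatrix_mul]
      simp [hc0, hr0, hM0]
    obtain ⟨P, hP, Q, hQ, d, hd, hPQ⟩ := exists_integralGL_mul_mul_eq_diagonal n M
    have hd0 : ∀ i, ‖d i‖ ≤ ‖B 0 0‖ := fun i => by
      have h1 : d i = (P.1 * M * Q.1) i i := by rw [hPQ, Matrix.diagonal_apply_eq]
      rw [h1]
      simpa using mul_entry_le (by positivity) zero_le_one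
        (mul_entry_le zero_le_one (norm_nonneg _) (mem_integralGL_iff.1 hP).1 hM)
        (mem_integralGL_iff.1 hQ).1 i i
    refine ⟨oneSumGL P * colGL c * permGL F (Equiv.swap 0 p.1),
      mul_mem (mul_mem (oneSumGL_mem hP) (colGL_mem hc)) (permGL_mem _),
      permGL F (Equiv.swap 0 p.2) * rowGL r * oneSumGL Q,
      mul_mem (mul_mem (permGL_mem _) (rowGL_mem hr)) (oneSumGL_mem hQ),
      Fin.cons (B 0 0) d, ?_, ?_⟩
    · intro i j
      refine Fin.cases ?_ (fun i => ?_) i <;> refine Fin.cases ?_ (fun j => ?_) j <;> intro hij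
      · simp
      · simpa using hd0 j
      · exact absurd hij (by simp)
      · simpa using hd i j (by simpa using hij)
    · have hdd : (Matrix.of fun i j : Fin n =>
          Matrix.diagonal (Fin.cons (B 0 0) d : Fin (n + 1) → F) i.succ j.succ) =
          Matrix.diagonal d := by
        ext i j; simp [Matrix.diagonal_apply]
      have hd1 : (fun j : Fin n => Matrix.diagonal (Fin.cons (B 0 0) d : Fin (n + 1) → F)
          0 j.succ) = 0 := by
        ext j; exact Matrix.diagonal_apply_ne _ (Fin.succ_ne_zero j).symm
      have hd2 : (fun i : Fin n => Matrix.diagonal (Fin.cons (B 0 0) d : Fin (n + 1) → F)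
          i.succ 0) = 0 := by
        ext j; exact Matrix.diagonal_apply_ne _ (Fin.succ_ne_zero j)
      calc _ = (oneSumGL P).1 * ((colGL c).1 * ((permGL F (Equiv.swap 0 p.1)).1 * A *
            (permGL F (Equiv.swap 0 p.2)).1) * (rowGL r).1) * (oneSumGL Q).1 := by
            simp only [Units.val_mul, mul_assoc]
        _ = Matrix.diagonal (Fin.cons (B 0 0) d : Fin (n + 1) → F) := by
            rw [← hB, hclear, eq_borderMatrix (Matrix.diagonal _), hdd, hd1, hd2, ← hPQ]
            simp only [oneSumGL]
            rw [borderMatrix_mul, borderMatrix_mul]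
            simp

theorem exists_cartan_decomposition (g : GL (Fin n) F) :
    ∃ P ∈ integralGL F n, ∃ Q ∈ integralGL F n, ∃ d : Fin n → Fˣ,
      (∀ i j, i ≤ j → ‖(d j : F)‖ ≤ ‖(d i : F)‖) ∧ g = P * diagGL F n d * Q := by
  obtain ⟨P, hP, Q, hQ, d, hd, hPQ⟩ := exists_integralGL_mul_mul_eq_diagonal n g.1
  have hd0 : ∀ i, d i ≠ 0 := by
    have hu : IsUnit (Matrix.diagonal d).det := by
      rw [← hPQ, ← Units.val_mul, ← Units.val_mul]
      exact (Matrix.isUnit_iff_isUnit_det _).1 (P * g * Q).isUnit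
    rw [Matrix.det_diagonal, isUnit_iff_ne_zero, Finset.prod_ne_zero_iff] at hu
    exact fun i => hu i (Finset.mem_univ i)
  refine ⟨P⁻¹, inv_mem hP, Q⁻¹, inv_mem hQ, fun i => Units.mk0 (d i) (hd0 i), hd, ?_⟩
  have : P * g * Q = diagGL F n fun i => Units.mk0 (d i) (hd0 i) := Units.ext hPQ
  rw [← this]
  group

theorem diagGL_mem {d : Fin n → Fˣ} (hd : ∀ i, ‖(d i : F)‖ = 1) :
    diagGL F n d ∈ integralGL F n := by
  refine mem_integralGL_iff.2 ⟨fun i j => ?_, fun i j => ?_⟩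
  · rw [diagGL_val, Matrix.diagonal_apply]
    split_ifs <;> simp [hd]
  · rw [← map_inv, diagGL_val, Matrix.diagonal_apply]
    split_ifs <;> simp [hd]

/-- Distinct permutation matrices lie in distinct cosets: their difference has an entry of norm `1`,
while congruence would force all entries below `1`. -/
theorem factorial_le_relIndex [LocallyCompactSpace F] {ϖ : integers F} (hϖ : IsUniformizer ϖ)
    {m : ℕ} (hm : 1 ≤ m) :
    n.factorial ≤ (congruenceSubgroup n hϖ m hm).relIndex (integralGL F n) := by
  have hfin : ((congruenceSubgroup n hϖ m hm).subgroupOf (integralGL F n)).FiniteIndex :=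
    finiteIndex_subgroupOf_of_isOpen isCompact_integralGL (isOpen_congruenceSubgroup hϖ hm)
  have hc1 : ‖(ϖ : F)‖ ^ m < 1 := pow_lt_one₀ (norm_nonneg _) hϖ.norm_lt_one (by omega)
  rw [Subgroup.relIndex, Subgroup.index]
  have hcard : n.factorial = Nat.card (Equiv.Perm (Fin n)) := by
    rw [Nat.card_eq_fintype_card, Fintype.card_perm, Fintype.card_fin]
  rw [hcard]
  refine Nat.card_le_card_of_injective
    (fun σ => (QuotientGroup.mk (⟨permGL F σ, permGL_mem σ⟩ : integralGL F n) :
      integralGL F n ⧸ (congruenceSubgroup n hϖ m hm).subgroupOf (integralGL F n))) ?_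
  intro σ τ h
  have h1 : (permGL F σ)⁻¹ * permGL F τ ∈ congruenceSubgroup n hϖ m hm := by
    simpa [Subgroup.mem_subgroupOf] using QuotientGroup.eq.1 h
  ext i
  by_contra hne
  have e : (permGL F σ).1 * (1 - ((permGL F σ)⁻¹ * permGL F τ).1) =
      (permGL F σ).1 - (permGL F τ).1 := by
    rw [mul_sub, mul_one, ← Units.val_mul, mul_inv_cancel_left]
  have h2 := mul_entry_le zero_le_one (by positivity)
    (mem_integralGL_iff.1 (permGL_mem (F := F) σ)).1 h1 i (σ i)
  rw [e, one_mul] at h2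
  have h3 : ((permGL F σ).1 - (permGL F τ).1) i (σ i) = 1 := by
    have hne' : τ i ≠ σ i := fun h => hne (congrArg Fin.val h.symm)
    simp [permGL, PEquiv.toMatrix_apply, hne']
  rw [h3, norm_one] at h2
  linarith

end Cartan

/-! ### Averaging over a group acting with finite-index stabilizers. -/

section Averaging

attribute [local instance] Subgroup.fintypeQuotientOfFiniteIndex

variable {K V : Type*} [Group K] [AddCommGroup V] [Module ℂ V] (ρ : Representation ℂ K V)

/-- The average of the translates of a vector by representatives of `K ⧸ N`. -/
noncomputable def cosetAverage (N : Subgroup K) [N.FiniteIndex] : V →ₗ[ℂ] V :=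
  (Fintype.card (K ⧸ N) : ℂ)⁻¹ • ∑ q : K ⧸ N, ρ q.out

variable {ρ}

theorem cosetAverage_apply (N : Subgroup K) [N.FiniteIndex] (u : V) :
    cosetAverage ρ N u = (Fintype.card (K ⧸ N) : ℂ)⁻¹ • ∑ q : K ⧸ N, ρ q.out u := by
  simp [cosetAverage]

theorem rho_out_mk {N : Subgroup K} {u : V} (hu : ∀ h ∈ N, ρ h u = u) (k : K) :
    ρ (QuotientGroup.mk k : K ⧸ N).out u = ρ k u := by
  obtain ⟨h, hh⟩ := QuotientGroup.mk_out_eq_mul N k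
  rw [hh, map_mul, Module.End.mul_apply, hu h h.2]

theorem rho_cosetAverage {N : Subgroup K} [N.FiniteIndex] {u : V} (hu : ∀ h ∈ N, ρ h u = u)
    (k : K) : ρ k (cosetAverage ρ N u) = cosetAverage ρ N u := by
  rw [cosetAverage_apply, map_smul, map_sum]
  congr 1
  refine Fintype.sum_equiv (MulAction.toPerm k) _ _ fun q => ?_
  rw [← Module.End.mul_apply, ← map_mul, ← rho_out_mk hu]
  congr 3
  conv_rhs => rw [← QuotientGroup.out_eq' q]
  rfl

theorem card_smul_inv_smul {ι : Type*} [Fintype ι] [Nonempty ι] (u : V) :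
    (Fintype.card ι : ℂ)⁻¹ • ∑ _i : ι, u = u := by
  rw [Finset.sum_const, Finset.card_univ, ← Nat.cast_smul_eq_nsmul ℂ, smul_smul,
    inv_mul_cancel₀ (Nat.cast_ne_zero.2 Fintype.card_ne_zero), one_smul]

theorem cosetAverage_of_invariant {N : Subgroup K} [N.FiniteIndex] {u : V} (hu : ∀ k, ρ k u = u) :
    cosetAverage ρ N u = u := by
  rw [cosetAverage_apply]
  simp_rw [hu]
  exact card_smul_inv_smul u

theorem cosetAverage_rho {N : Subgroup K} [N.FiniteIndex] [N.Normal] {u : V}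
    (hu : ∀ h ∈ N, ρ h u = u) (k : K) : cosetAverage ρ N (ρ k u) = cosetAverage ρ N u := by
  rw [cosetAverage_apply, cosetAverage_apply]
  congr 1
  refine Fintype.sum_equiv (Equiv.mulRight (QuotientGroup.mk k : K ⧸ N)) _ _ fun q => ?_
  rw [← Module.End.mul_apply, ← map_mul, ← rho_out_mk hu]
  congr 3
  rw [QuotientGroup.mk_mul, QuotientGroup.out_eq']
  rfl

/-- The `N'`-average fixes the invariant vector `cosetAverage ρ N u`; distributed over the sum
instead, it absorbs each translate, which uses normality of `N'`. -/
theorem cosetAverage_eq {N N' : Subgroup K} [N.FiniteIndex] [N'.FiniteIndex] [N'.Normal] {u : V}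
    (hu : ∀ h ∈ N, ρ h u = u) (hu' : ∀ h ∈ N', ρ h u = u) :
    cosetAverage ρ N' u = cosetAverage ρ N u := by
  rw [← cosetAverage_of_invariant (N := N') (rho_cosetAverage hu), cosetAverage_apply N,
    map_smul, map_sum]
  simp_rw [cosetAverage_rho hu']
  exact (card_smul_inv_smul _).symm

theorem exists_average (hfin : ∀ u : V, ∃ N : Subgroup K, N.FiniteIndex ∧ ∀ h ∈ N, ρ h u = u) :
    ∃ e : V →ₗ[ℂ] V, ∀ (N : Subgroup K) [N.FiniteIndex] (u : V), (∀ h ∈ N, ρ h u = u) →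
      e u = cosetAverage ρ N u := by
  choose N hN hNu using hfin
  have hcore : ∀ u, (N u).normalCore.FiniteIndex := fun u => inferInstance
  have hfix : ∀ u, ∀ h ∈ (N u).normalCore, ρ h u = u :=
    fun u h hh => hNu u h ((N u).normalCore_le hh)
  have key : ∀ (M : Subgroup K) [M.FiniteIndex] (u : V), (∀ h ∈ M, ρ h u = u) →
      cosetAverage ρ (N u).normalCore u = cosetAverage ρ M u :=
    fun M _ u hu => cosetAverage_eq hu (hfix u)
  refine ⟨{ toFun := fun u => cosetAverage ρ (N u).normalCore u
            map_add' := fun u w => ?_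
            map_smul' := fun c u => ?_ }, key⟩
  -- Additivity: compute all three averages with one subgroup fixing both vectors.
  · have hu : ∀ h ∈ (N u).normalCore ⊓ (N w).normalCore, ρ h u = u := fun h hh => hfix u h hh.1
    have hw : ∀ h ∈ (N u).normalCore ⊓ (N w).normalCore, ρ h w = w := fun h hh => hfix w h hh.2
    rw [key _ u hu, key _ w hw, key ((N u).normalCore ⊓ (N w).normalCore) (u + w)
      (fun h hh => by rw [map_add, hu h hh, hw h hh]), map_add]
  · have hu : ∀ h ∈ (N u).normalCore, ρ h (c • u) = c • u := fun h hh => by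
      rw [map_smul, hfix u h hh]
    rw [key _ _ hu, map_smul, RingHom.id_apply]

end Averaging

/-! ### Hecke operators on the fixed vectors. -/

section Hecke

attribute [local instance] Subgroup.fintypeQuotientOfFiniteIndex

variable {G V : Type*} [Group G] [AddCommGroup V] [Module ℂ V] {π : Representation ℂ G V}
  {K : Subgroup G}

theorem mem_fixedVectors {v : V} : v ∈ fixedVectors π K ↔ ∀ k ∈ K, π k v = v :=
  ⟨fun h k hk => h ⟨k, hk⟩, fun h k => h k.1 k.2⟩

variable (π K) in
/-- `e` is the projection onto `V^K` given by averaging over `K`. -/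
structure IsAverage (e : V →ₗ[ℂ] V) : Prop where
  apply_mem : ∀ u, e u ∈ fixedVectors π K
  apply_of_mem : ∀ u ∈ fixedVectors π K, e u = u
  apply_rho : ∀ k ∈ K, ∀ u, e (π k u) = e u
  exists_finset : ∀ H : Subgroup G, (H.subgroupOf K).FiniteIndex →
    ∃ s : Finset G, s.Nonempty ∧ (∀ k ∈ s, k ∈ K) ∧
      ∀ u, (∀ h ∈ H, π h u = u) → e u = (s.card : ℂ)⁻¹ • ∑ k ∈ s, π k u
  exists_stabilizer : ∀ u, ∃ H : Subgroup G, (H.subgroupOf K).FiniteIndex ∧ ∀ h ∈ H, π h u = u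

theorem exists_isAverage (hfin : ∀ u : V, ∃ H : Subgroup G,
    (H.subgroupOf K).FiniteIndex ∧ ∀ h ∈ H, π h u = u) : ∃ e, IsAverage π K e := by
  classical
  let ρ : Representation ℂ K V := π.comp K.subtype
  have hρ : ∀ (k : K) (u : V), ρ k u = π k u := fun _ _ => rfl
  have hfin' : ∀ u : V, ∃ N : Subgroup K, N.FiniteIndex ∧ ∀ h ∈ N, ρ h u = u := fun u => by
    obtain ⟨H, hH, hu⟩ := hfin u
    exact ⟨H.subgroupOf K, hH, fun h hh => hu h hh⟩
  obtain ⟨e, he⟩ := exists_average hfin'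
  refine ⟨e, fun u => ?_, fun u hu => ?_, fun k hk u => ?_, fun H hH => ?_, hfin⟩
  · obtain ⟨N, hN, hu⟩ := hfin' u
    rw [he N u hu]
    exact mem_fixedVectors.2 fun k hk => rho_cosetAverage hu ⟨k, hk⟩
  · obtain ⟨N, hN, hu'⟩ := hfin' u
    rw [he N u hu']
    exact cosetAverage_of_invariant fun k => mem_fixedVectors.1 hu k.1 k.2
  · obtain ⟨N, hN, hu⟩ := hfin' u
    have hc : ∀ h ∈ N.normalCore, ρ h u = u := fun h hh => hu h (N.normalCore_le hh)
    rw [he N.normalCore u hc, he N.normalCore (π k u), ← cosetAverage_rho hc ⟨k, hk⟩, hρ]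
    intro h hh
    have h2 := hc _ (N.normalCore_normal.conj_mem' h hh ⟨k, hk⟩)
    calc ρ h (π k u) = ρ (⟨k, hk⟩ * (⟨k, hk⟩⁻¹ * h * ⟨k, hk⟩)) u := by
          rw [← mul_assoc, mul_inv_cancel_left, map_mul]; rfl
      _ = π k u := by rw [map_mul, Module.End.mul_apply, h2, hρ]
  · let f : K ⧸ H.subgroupOf K → G := fun q => q.out.1
    have hf : Function.Injective f := Subtype.val_injective.comp (Quotient.out_injective)
    refine ⟨Finset.univ.image f, Finset.univ_nonempty.image f, ?_, fun u hu => ?_⟩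
    · simp only [Finset.mem_image]
      rintro _ ⟨q, -, rfl⟩
      exact q.out.2
    · rw [he (H.subgroupOf K) u fun h hh => hu h hh, cosetAverage_apply,
        Finset.card_image_of_injective _ hf, Finset.sum_image fun a _ b _ h => hf h]
      rfl

namespace IsAverage

variable {e : V →ₗ[ℂ] V} (he : IsAverage π K e)

theorem apply_eq_of_forall (he : IsAverage π K e) {W : Type*} [AddCommGroup W] [Module ℂ W] (f : V →ₗ[ℂ] W) (u : V)
    (hf : ∀ k ∈ K, f (π k u) = f u) : f (e u) = f u := by
  obtain ⟨H, hH, hu⟩ := he.exists_stabilizer u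
  obtain ⟨s, hs, hsK, hse⟩ := he.exists_finset H hH
  rw [hse u hu, map_smul, map_sum, Finset.sum_congr rfl fun k hk => hf k (hsK k hk),
    Finset.sum_const, ← Nat.cast_smul_eq_nsmul ℂ, smul_smul,
    inv_mul_cancel₀ (Nat.cast_ne_zero.2 hs.card_pos.ne'), one_smul]

/-- The Hecke operator of the double coset `K g K` on `V^K`, up to normalization. -/
noncomputable def hecke (g : G) : Module.End ℂ (fixedVectors π K) :=
  (e ∘ₗ π g ∘ₗ (fixedVectors π K).subtype).codRestrict _ fun _ => he.apply_mem _

theorem coe_hecke (g : G) (v : fixedVectors π K) : (he.hecke g v : V) = e (π g v) := rfl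

/-- The inner projection in `e (a (e (b v)))` can be dropped: for `k = y * z`, `a k b = (a y a⁻¹) (a
b) (b⁻¹ z b)`, where the left factor is absorbed by `e` and the right one by `v`. -/
theorem hecke_mul_of_factorization {a b : G}
    (h : ∀ k ∈ K, ∃ y z, k = y * z ∧ a * y * a⁻¹ ∈ K ∧ b⁻¹ * z * b ∈ K) :
    he.hecke (a * b) = he.hecke a * he.hecke b := by
  ext v
  rw [Module.End.mul_apply, coe_hecke, coe_hecke, coe_hecke]
  rw [map_mul, Module.End.mul_apply]
  refine (he.apply_eq_of_forall (e ∘ₗ π a) (π b v) fun k hk => ?_).symm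
  obtain ⟨y, z, rfl, hy, hz⟩ := h k hk
  have h1 : π b v = π b (π (b⁻¹ * z * b) v) := by rw [mem_fixedVectors.1 v.2 _ hz]
  have h2 : e (π a (π b v)) = e (π (a * y * a⁻¹) (π a (π b (π (b⁻¹ * z * b) v)))) := by
    rw [he.apply_rho _ hy, ← h1]
  simp only [LinearMap.comp_apply]
  rw [h2]
  simp only [← Module.End.mul_apply, ← map_mul]
  congr 3
  group

theorem hecke_mul_of_normalizes_left {a : G} (ha : ∀ k ∈ K, a * k * a⁻¹ ∈ K) (b : G) :
    he.hecke (a * b) = he.hecke a * he.hecke b :=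
  he.hecke_mul_of_factorization fun k hk => ⟨k, 1, by simp, ha k hk, by simp [one_mem]⟩

theorem hecke_mul_of_normalizes_right (a : G) {b : G} (hb : ∀ k ∈ K, b⁻¹ * k * b ∈ K) :
    he.hecke (a * b) = he.hecke a * he.hecke b :=
  he.hecke_mul_of_factorization fun k hk => ⟨1, k, by simp, by simp [one_mem], hb k hk⟩

theorem hecke_one : he.hecke 1 = 1 := by
  ext v
  rw [coe_hecke, map_one]
  exact he.apply_of_mem _ v.2

theorem hecke_mul_of_mem (a : G) {k : G} (hk : k ∈ K) : he.hecke (a * k) = he.hecke a := by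
  ext v
  rw [coe_hecke, coe_hecke, map_mul, Module.End.mul_apply, mem_fixedVectors.1 v.2 k hk]

/-- As `π b v` is fixed by `b K b⁻¹`, its projection is an average over a finite set of `k ∈ K`
independent of `v`. -/
theorem hecke_mul_mem_span (hconj : ∀ g : G, ((K.map (MulAut.conj g).toMonoidHom).subgroupOf
    K).FiniteIndex) (a b : G) :
    he.hecke a * he.hecke b ∈ Submodule.span ℂ (Set.range he.hecke) := by
  obtain ⟨s, hs, hsK, hse⟩ := he.exists_finset _ (hconj b)
  have : he.hecke a * he.hecke b = (s.card : ℂ)⁻¹ • ∑ k ∈ s, he.hecke (a * k * b) := by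
    ext v
    rw [Module.End.mul_apply, coe_hecke, coe_hecke, hse (π b v)]
    · simp only [map_smul, map_sum, LinearMap.smul_apply, LinearMap.sum_apply, Submodule.coe_smul,
        Submodule.coe_sum, coe_hecke, map_mul, Module.End.mul_apply]
    · rintro _ ⟨k, hk, rfl⟩
      rw [← Module.End.mul_apply, ← map_mul]
      simp only [MulEquiv.toMonoidHom_eq_coe, MonoidHom.coe_coe, MulAut.conj_apply,
        inv_mul_cancel_right]
      rw [map_mul, Module.End.mul_apply, mem_fixedVectors.1 v.2 k hk]
  rw [this]
  exact Submodule.smul_mem _ _ (Submodule.sum_mem _ fun k _ => Submodule.subset_span ⟨_, rfl⟩)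

/-- For irreducible `π` the Hecke operators span `End (V^K)`. -/
theorem span_range_hecke_eq_top (hirr : π.IsIrreducible)
    [FiniteDimensional ℂ (fixedVectors π K)]
    (hconj : ∀ g : G, ((K.map (MulAut.conj g).toMonoidHom).subgroupOf K).FiniteIndex) :
    Submodule.span ℂ (Set.range he.hecke) = ⊤ := by
  let S : Subalgebra ℂ (Module.End ℂ (fixedVectors π K)) :=
    (Submodule.span ℂ (Set.range he.hecke)).toSubalgebra
      (Submodule.subset_span ⟨1, he.hecke_one⟩) (fun x y hx hy => by
        have := Submodule.mul_mem_mul hx hy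
        rw [Submodule.span_mul_span] at this
        refine Submodule.span_le.2 ?_ this
        rintro _ ⟨_, ⟨a, rfl⟩, _, ⟨b, rfl⟩, rfl⟩
        exact he.hecke_mul_mem_span hconj a b)
  have hS : S = ⊤ := by
    refine subalgebra_eq_top_of_transitive S fun v hv w => ?_
    -- The orbit of `v` spans `V` by irreducibility; applying `e` to an expression of `w` as a
    -- combination of translates of `v` yields a combination of Hecke operators sending `v` to `w`.
    let U : Subrepresentation π :=
      ⟨Submodule.span ℂ (Set.range fun g => π g v), fun g u hu => by
        have h1 : Submodule.span ℂ (Set.range fun g => π g v) ≤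
            (Submodule.span ℂ (Set.range fun g => π g v)).comap (π g) := by
          rw [Submodule.span_le]
          rintro _ ⟨h, rfl⟩
          refine Submodule.subset_span ⟨g * h, ?_⟩
          simp
        exact h1 hu⟩
    have hvU : (v : V) ∈ U.toSubmodule := Submodule.subset_span ⟨1, by simp⟩
    have hU : U = ⊤ := by
      refine (hirr.eq_bot_or_eq_top U).resolve_left fun hbot => hv ?_
      rw [hbot] at hvU
      exact Subtype.ext hvU
    have hw : (w : V) ∈ Submodule.span ℂ (Set.range fun g => π g v) := by
      change (w : V) ∈ U.toSubmodule
      rw [hU]; trivial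
    obtain ⟨c, hc⟩ := (Finsupp.mem_span_range_iff_exists_finsupp).1 hw
    refine ⟨c.sum fun g a => a • he.hecke g, ?_, ?_⟩
    · exact Submodule.sum_mem _ fun g _ => Submodule.smul_mem _ _ (Submodule.subset_span ⟨g, rfl⟩)
    · apply Subtype.ext
      rw [← he.apply_of_mem _ w.2, ← hc]
      simp [Finsupp.sum, coe_hecke, map_sum]
  have := congrArg Subalgebra.toSubmodule hS
  simpa [S] using this

/-- The operator of `z` commutes with all Hecke operators, which span the endomorphism algebra, and
the centre of that algebra is the scalars. -/
theorem exists_hecke_eq_smul_one (hirr : π.IsIrreducible)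
    [FiniteDimensional ℂ (fixedVectors π K)]
    (hconj : ∀ g : G, ((K.map (MulAut.conj g).toMonoidHom).subgroupOf K).FiniteIndex)
    {z : G} (hz : z ∈ Subgroup.center G) : ∃ c : ℂ, he.hecke z = c • 1 := by
  have hz' : ∀ g, z * g = g * z := fun g => (Subgroup.mem_center_iff.1 hz g).symm
  have h1 : ∀ k ∈ K, z * k * z⁻¹ ∈ K := fun k hk => by rwa [hz', mul_inv_cancel_right]
  have h2 : ∀ k ∈ K, z⁻¹ * k * z ∈ K := fun k hk => by
    rwa [mul_assoc, ← hz', inv_mul_cancel_left]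
  have hcomm : ∀ f : Module.End ℂ (fixedVectors π K), f * he.hecke z = he.hecke z * f := by
    intro f
    have hf : f ∈ Submodule.span ℂ (Set.range he.hecke) := by
      rw [he.span_range_hecke_eq_top hirr hconj]; trivial
    induction hf using Submodule.span_induction with
    | mem f hf =>
      obtain ⟨g, rfl⟩ := hf
      rw [← he.hecke_mul_of_normalizes_left h1, ← he.hecke_mul_of_normalizes_right _ h2, hz']
    | zero => simp
    | add f g _ _ hf hg => rw [add_mul, mul_add, hf, hg]
    | smul c f _ hf => rw [smul_mul_assoc, mul_smul_comm, hf]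
  have hcen : he.hecke z ∈ Subalgebra.center ℂ (Module.End ℂ (fixedVectors π K)) :=
    Subalgebra.mem_center_iff.2 hcomm
  rw [Algebra.IsCentral.center_eq_bot, Algebra.mem_bot] at hcen
  obtain ⟨c, hc⟩ := hcen
  exact ⟨c, by rw [← hc, Algebra.algebraMap_eq_smul_one]⟩

end IsAverage

end Hecke

/-! ### Coweights, the dimension bound and the comparison with Bernstein's bound. -/

section Bound

/-- Pair factors: `(i + 1) * (n - i) = n + i * (n - 1 - i) ≥ n`, strictly at `i = 1`. -/
theorem pow_self_lt_factorial_sq {n : ℕ} (hn : 3 ≤ n) : n ^ n < n.factorial ^ 2 := by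
  have h1 : n.factorial ^ 2 = ∏ i ∈ Finset.range n, (i + 1) * (n - i) := by
    rw [Finset.prod_mul_distrib, Finset.prod_range_add_one_eq_factorial, sq]
    congr 1
    rw [← Finset.prod_range_add_one_eq_factorial, ← Finset.prod_range_reflect]
    refine Finset.prod_congr rfl fun i hi => ?_
    have := Finset.mem_range.1 hi
    omega
  have h2 : n ^ n = ∏ _i ∈ Finset.range n, n := by simp
  rw [h1, h2]
  refine Finset.prod_lt_prod (fun i _ => by omega) (fun i hi => ?_)
    ⟨1, Finset.mem_range.2 (by omega), by omega⟩
  have := Finset.mem_range.1 hi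
  obtain ⟨c, rfl⟩ := Nat.exists_eq_add_of_lt this
  rw [show i + c + 1 - i = c + 1 by omega]
  nlinarith [Nat.zero_le (i * c)]

theorem natCast_rpow_half_sq (n : ℕ) : ((n : ℝ) ^ ((n : ℝ) / 2)) ^ 2 = (n : ℝ) ^ n := by
  rw [← Real.rpow_natCast, ← Real.rpow_mul (Nat.cast_nonneg n)]
  norm_num

theorem pow_mul_rpow_lt_pow_two_pow {n N : ℕ} (hn : 3 ≤ n) (hN : n.factorial ≤ N) :
    (N : ℝ) ^ n * (n : ℝ) ^ ((n : ℝ) / 2) < (N : ℝ) ^ (2 ^ (n - 1)) := by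
  have h1 : (n : ℝ) ^ ((n : ℝ) / 2) < N := by
    refine lt_of_pow_lt_pow_left₀ 2 (Nat.cast_nonneg N) ?_
    rw [natCast_rpow_half_sq]
    exact_mod_cast (pow_self_lt_factorial_sq hn).trans_le (Nat.pow_le_pow_left hN 2)
  have hN1 : 1 ≤ N := n.factorial_pos.trans_le hN
  have hN0 : (0 : ℝ) < N := by exact_mod_cast hN1
  have h2 : n + 1 ≤ 2 ^ (n - 1) := by
    obtain ⟨k, rfl⟩ := Nat.exists_eq_add_of_le hn
    rw [show 3 + k - 1 = k + 2 by omega, pow_add]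
    have := Nat.lt_two_pow_self (n := k)
    omega
  calc (N : ℝ) ^ n * (n : ℝ) ^ ((n : ℝ) / 2) < (N : ℝ) ^ n * N := by gcongr
    _ = (N : ℝ) ^ (n + 1) := (pow_succ _ _).symm
    _ ≤ _ := pow_le_pow_right₀ (by exact_mod_cast hN1) h2

variable {F : Type*} [NontriviallyNormedField F] [IsUltrametricDist F] {l : ℕ}

/-- The diagonal entries of the `i`-th fundamental coweight, with `i + 1` entries `1` followed by
entries `ϖ`. -/
def fundamentalCoweight (p : Fˣ) (i : Fin l) (j : Fin (l + 1)) : Fˣ :=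
  if i.castSucc < j then p else 1

theorem sum_ite_castSucc_lt (e : Fin (l + 1) → ℤ) (j : Fin (l + 1)) :
    ∑ i : Fin l, (if i.castSucc < j then e i.succ - e i.castSucc else 0) = e j - e 0 := by
  induction j using Fin.induction with
  | zero => simp
  | succ j ih =>
    have h : ∀ i : Fin l, (if i.castSucc < j.succ then e i.succ - e i.castSucc else 0) =
        (if i.castSucc < j.castSucc then e i.succ - e i.castSucc else 0) +
          if j = i then e i.succ - e i.castSucc else 0 := by
      intro i
      rcases lt_trichotomy i j with hij | rfl | hij
      · rw [if_pos, if_pos, if_neg hij.ne', add_zero]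
        · exact hij
        · exact Fin.castSucc_lt_succ_iff.2 hij.le
      · simp
      · rw [if_neg, if_neg, if_neg hij.ne, add_zero]
        · exact fun h => absurd h (not_lt.2 hij.le)
        · exact fun h => absurd (Fin.castSucc_lt_succ_iff.1 h) (not_le.2 hij)
    simp_rw [h, Finset.sum_add_distrib, ih]
    simp

/-- A diagonal matrix with decreasing absolute values is a product of a scalar, fundamental
coweights and an integral diagonal matrix. -/
theorem exists_eq_scalar_mul_coweights {ϖ : integers F} (hϖ : IsUniformizer ϖ) (p : Fˣ)
    (hp : (p : F) = ϖ) (d : Fin (l + 1) → Fˣ)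
    (hd : ∀ i j, i ≤ j → ‖(d j : F)‖ ≤ ‖(d i : F)‖) :
    ∃ (c : Fˣ) (δ : Fin l → ℕ) (u : Fin (l + 1) → Fˣ), (∀ j, ‖(u j : F)‖ = 1) ∧
      d = (fun _ => c) * (∏ i, fundamentalCoweight p i ^ δ i) * u := by
  choose e he using fun j => hϖ.exists_norm_eq_zpow (d j).ne_zero
  have hmono : ∀ i j, i ≤ j → e i ≤ e j := by
    intro i j hij
    have := hd i j hij
    rw [he, he] at this
    exact (zpow_le_zpow_iff_right_of_lt_one₀ hϖ.norm_pos hϖ.norm_lt_one).1 this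
  -- Exponents are the successive jumps of the valuation, nonnegative by dominance; they telescope,
  -- and the scalar `p ^ e 0` supplies the starting value.
  let δ : Fin l → ℕ := fun i => (e i.succ - e i.castSucc).toNat
  have hδ : ∀ i, (δ i : ℤ) = e i.succ - e i.castSucc := fun i =>
    Int.toNat_of_nonneg (sub_nonneg.2 (hmono _ _ (Fin.castSucc_lt_succ).le))
  have hb : ∀ j, ‖((∏ i, fundamentalCoweight p i ^ δ i : Fin (l + 1) → Fˣ) j : F)‖ =
      ‖(ϖ : F)‖ ^ (e j - e 0) := by
    intro j
    have h1 : (∏ i, fundamentalCoweight p i ^ δ i : Fin (l + 1) → Fˣ) j =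
        p ^ ∑ i : Fin l, (if i.castSucc < j then δ i else 0) := by
      rw [Finset.prod_apply, ← Finset.prod_pow_eq_pow_sum]
      refine Finset.prod_congr rfl fun i _ => ?_
      rw [Pi.pow_apply, fundamentalCoweight]
      split_ifs <;> simp
    rw [h1, ← sum_ite_castSucc_lt e j, Units.val_pow_eq_pow_val, hp, norm_pow, ← zpow_natCast]
    congr 1
    push_cast
    simp_rw [hδ]
  refine ⟨p ^ e 0, δ, d / ((fun _ => p ^ e 0) * ∏ i, fundamentalCoweight p i ^ δ i),
    fun j => ?_, by rw [mul_div_cancel]⟩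
  rw [Pi.div_apply, Pi.mul_apply, Units.val_div_eq_div_val, Units.val_mul, norm_div, norm_mul, hb,
    he, Units.val_zpow_eq_zpow_val, hp, norm_zpow, ← zpow_add₀ hϖ.norm_pos.ne', add_sub_cancel,
    div_self (zpow_ne_zero _ hϖ.norm_pos.ne')]

theorem fundamentalCoweight_antitone {F : Type*} [NontriviallyNormedField F] {p : Fˣ} (hp : ‖(p : F)‖ ≤ 1) (k : Fin l)
    (i j : Fin (l + 1)) (hij : i ≤ j) :
    ‖(fundamentalCoweight p k j : F)‖ ≤ ‖(fundamentalCoweight p k i : F)‖ := by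
  unfold fundamentalCoweight
  by_cases h1 : k.castSucc < i
  · rw [if_pos h1, if_pos (h1.trans_le hij)]
  · rw [if_neg h1]
    split_ifs <;> simp [hp]

/-- Split the indices after position `i`. Conjugation by dominant `d` does not expand the lower-left
block, where `y` lives; conjugation by the inverse coweight fixes the diagonal blocks and does not
expand the upper-right block, and `z` has no lower-left block. -/
theorem coweight_factorization {ϖ : integers F} (hϖ : IsUniformizer ϖ) {m : ℕ} (hm : 1 ≤ m)
    {p : Fˣ} (hp : ‖(p : F)‖ ≤ 1) {d : Fin (l + 1) → Fˣ}
    (hd : ∀ i j, i ≤ j → ‖(d j : F)‖ ≤ ‖(d i : F)‖) (i : Fin l) {x : GL (Fin (l + 1)) F}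
    (hx : x ∈ congruenceSubgroup (l + 1) hϖ m hm) :
    ∃ y z, x = y * z ∧ diagGL F _ d * y * (diagGL F _ d)⁻¹ ∈ congruenceSubgroup (l + 1) hϖ m hm ∧
      (diagGL F _ (fundamentalCoweight p i))⁻¹ * z * diagGL F _ (fundamentalCoweight p i) ∈
        congruenceSubgroup (l + 1) hϖ m hm := by
  obtain ⟨y, hy, z, hz, hxyz, hy0, hz0⟩ :=
    exists_block_factorization hϖ hm (fun j => ¬ i.castSucc < j) hx
  have hsub : ∀ (c : Fin (l + 1) → Fˣ) (g : GL (Fin (l + 1)) F) a b,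
      (1 - (diagGL F _ c * g * (diagGL F _ c)⁻¹).1) a b = c a * (1 - g.1) a b * (c b : F)⁻¹ := by
    intro c g a b
    rw [Matrix.sub_apply, Matrix.sub_apply, diagGL_conj_apply, Matrix.one_apply]
    split_ifs with hab
    · subst hab
      rw [mul_sub, sub_mul, mul_one, mul_inv_cancel₀ (c a).ne_zero]
    · ring
  have hbound : ∀ (c : Fin (l + 1) → Fˣ) (g : GL (Fin (l + 1)) F),
      g ∈ congruenceSubgroup (l + 1) hϖ m hm →
      (∀ a b, (1 - g.1) a b ≠ 0 → ‖(c a : F)‖ ≤ ‖(c b : F)‖) →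
      diagGL F _ c * g * (diagGL F _ c)⁻¹ ∈ congruenceSubgroup (l + 1) hϖ m hm := by
    intro c g hg hc a b
    rw [hsub]
    by_cases h0 : (1 - g.1) a b = 0
    · rw [h0, mul_zero, zero_mul, norm_zero]; positivity
    · rw [norm_mul, norm_mul, norm_inv, mul_right_comm, ← div_eq_mul_inv]
      refine (mul_le_of_le_one_left (norm_nonneg _) ?_).trans (hg a b)
      exact div_le_one_of_le₀ (hc a b h0) (norm_nonneg _)
  refine ⟨y, z, hxyz, hbound d y hy fun a b hab => hd b a ?_, ?_⟩
  · by_contra hlt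
    refine hab (hy0 a b fun h => hlt ?_)
    exact (not_lt.1 h.2).trans (not_not.1 h.1).le
  · have h := hbound (fundamentalCoweight p i)⁻¹ z hz fun a b hab => ?_
    · rwa [map_inv, inv_inv] at h
    simp only [Pi.inv_apply, fundamentalCoweight]
    by_cases ha : i.castSucc < a
    · by_cases hb : i.castSucc < b
      · rw [if_pos ha, if_pos hb]
      · refine absurd ?_ hab
        have hne : a ≠ b := fun h => hb (h ▸ ha)
        rw [Matrix.sub_apply, Matrix.one_apply_ne hne, hz0 a b (not_not.2 ha) hb, sub_zero]
    · rw [if_neg ha]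
      split_ifs
      · rw [inv_one, Units.val_one, norm_one, Units.val_inv_eq_inv_val, norm_inv]
        exact (one_le_inv₀ (norm_pos_iff.2 p.ne_zero)).2 hp
      · exact le_rfl

variable {V : Type*} [AddCommGroup V] [Module ℂ V] {π : Representation ℂ (GL (Fin (l + 1)) F) V}
  {ϖ : integers F} (hϖ : IsUniformizer ϖ) {m : ℕ} (hm : 1 ≤ m)

theorem hecke_mul_coweight {e : V →ₗ[ℂ] V} (he : IsAverage π (congruenceSubgroup (l + 1) hϖ m hm) e)
    {p : Fˣ} (hp : ‖(p : F)‖ ≤ 1) {d : Fin (l + 1) → Fˣ}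
    (hd : ∀ i j, i ≤ j → ‖(d j : F)‖ ≤ ‖(d i : F)‖) (i : Fin l) :
    he.hecke (diagGL F _ (d * fundamentalCoweight p i)) =
      he.hecke (diagGL F _ d) * he.hecke (diagGL F _ (fundamentalCoweight p i)) := by
  rw [map_mul]
  exact he.hecke_mul_of_factorization fun k hk => coweight_factorization hϖ hm hp hd i hk

theorem hecke_coweights_mem_adjoin {e : V →ₗ[ℂ] V}
    (he : IsAverage π (congruenceSubgroup (l + 1) hϖ m hm) e) {p : Fˣ} (hp : ‖(p : F)‖ ≤ 1)
    (δ : Fin l → ℕ) :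
    he.hecke (diagGL F _ (∏ i, fundamentalCoweight p i ^ δ i)) ∈
      Algebra.adjoin ℂ (Set.range fun i => he.hecke (diagGL F _ (fundamentalCoweight p i))) := by
  let M : Submonoid (Fin (l + 1) → Fˣ) :=
    Submonoid.closure (Set.range (fundamentalCoweight (l := l) p))
  have hmem : (∏ i, fundamentalCoweight p i ^ δ i : Fin (l + 1) → Fˣ) ∈ M :=
    M.prod_mem fun i _ => M.pow_mem (Submonoid.subset_closure ⟨i, rfl⟩) _
  generalize (∏ i, fundamentalCoweight p i ^ δ i : Fin (l + 1) → Fˣ) = d at hmem ⊢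
  -- Dominance is carried through the induction because multiplicativity needs it.
  suffices h : (∀ i j, i ≤ j → ‖(d j : F)‖ ≤ ‖(d i : F)‖) ∧ he.hecke (diagGL F _ d) ∈
      Algebra.adjoin ℂ (Set.range fun i => he.hecke (diagGL F _ (fundamentalCoweight p i))) from h.2
  induction hmem using Submonoid.closure_induction_right with
  | one =>
    refine ⟨by simp, ?_⟩
    rw [map_one, he.hecke_one]
    exact one_mem _
  | mul_right x hx y hy ih =>
    obtain ⟨i, rfl⟩ := hy
    refine ⟨fun a b hab => ?_, ?_⟩
    · simp only [Pi.mul_apply, Units.val_mul, norm_mul]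
      exact mul_le_mul (ih.1 a b hab) (fundamentalCoweight_antitone hp i a b hab) (norm_nonneg _)
        (norm_nonneg _)
    · rw [hecke_mul_coweight hϖ hm he hp ih.1]
      exact mul_mem ih.2 (Algebra.subset_adjoin ⟨i, rfl⟩)

theorem finrank_sq_le [LocallyCompactSpace F] (hirr : π.IsIrreducible) {e : V →ₗ[ℂ] V}
    (he : IsAverage π (congruenceSubgroup (l + 1) hϖ m hm) e) {p : Fˣ} (hp : (p : F) = ϖ)
    [FiniteDimensional ℂ (fixedVectors π (congruenceSubgroup (l + 1) hϖ m hm))] :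
    Module.finrank ℂ (fixedVectors π (congruenceSubgroup (l + 1) hϖ m hm)) ^ 2 ≤
      (congruenceSubgroup (l + 1) hϖ m hm).relIndex (integralGL F (l + 1)) ^ 2 *
        Module.finrank ℂ (Algebra.adjoin ℂ
          (Set.range fun i => he.hecke (diagGL F _ (fundamentalCoweight p i)))) := by
  set K := congruenceSubgroup (l + 1) hϖ m hm with hK
  set K₀ := integralGL F (l + 1) with hK₀
  set C := Algebra.adjoin ℂ (Set.range fun i => he.hecke (diagGL F _ (fundamentalCoweight p i)))
  have hKo : IsOpen (K : Set (GL (Fin (l + 1)) F)) := isOpen_congruenceSubgroup hϖ hm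
  have hKc : IsCompact (K : Set (GL (Fin (l + 1)) F)) := isCompact_congruenceSubgroup hϖ hm
  have hp1 : ‖(p : F)‖ ≤ 1 := by rw [hp]; exact hϖ.norm_lt_one.le
  have hconj : ∀ g, ((K.map (MulAut.conj g).toMonoidHom).subgroupOf K).FiniteIndex := by
    intro g
    refine finiteIndex_subgroupOf_of_isOpen hKc ?_
    have hcont : Continuous fun x : GL (Fin (l + 1)) F => g⁻¹ * x * g := by fun_prop
    convert hKo.preimage hcont using 1
    ext x
    constructor
    · rintro ⟨y, hy, rfl⟩
      simpa [mul_assoc] using hy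
    · intro hx
      exact ⟨g⁻¹ * x * g, hx, by simp [mul_assoc]⟩
  have hnorm : ∀ g ∈ K₀, ∀ k ∈ K, g * k * g⁻¹ ∈ K :=
    fun g hg k hk => conj_mem_congruenceSubgroup hϖ hm hg hk
  have hnorm' : ∀ g ∈ K₀, ∀ k ∈ K, g⁻¹ * k * g ∈ K := fun g hg k hk => by
    simpa using hnorm g⁻¹ (inv_mem hg) k hk
  have hfin : (K.subgroupOf K₀).FiniteIndex :=
    finiteIndex_subgroupOf_of_isOpen isCompact_integralGL hKo
  let Q := K₀ ⧸ K.subgroupOf K₀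
  let _ : Fintype Q := Subgroup.fintypeQuotientOfFiniteIndex
  have hQ : Fintype.card Q = K.relIndex K₀ := by
    rw [Subgroup.relIndex, Subgroup.index, Nat.card_eq_fintype_card]
  have hout : ∀ g (hg : g ∈ K₀),
      he.hecke (QuotientGroup.mk ⟨g, hg⟩ : Q).out.1 = he.hecke g := by
    intro g hg
    obtain ⟨h, hh⟩ := QuotientGroup.mk_out_eq_mul (K.subgroupOf K₀) ⟨g, hg⟩
    rw [hh]
    exact he.hecke_mul_of_mem g h.2
  let Φ : (Q × Q → C) →ₗ[ℂ] Module.End ℂ (fixedVectors π K) :=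
    ∑ q : Q × Q, LinearMap.mulLeft ℂ (he.hecke q.1.out.1) ∘ₗ
      LinearMap.mulRight ℂ (he.hecke q.2.out.1) ∘ₗ C.val.toLinearMap ∘ₗ LinearMap.proj q
  have hΦ : ∀ f, Φ f = ∑ q : Q × Q, he.hecke q.1.out.1 * (f q * he.hecke q.2.out.1) := by
    intro f
    simp [Φ]
  -- Surjectivity is the Cartan decomposition: the integral factors reduce to coset representatives,
  -- the scalar acts as a constant `a`, and the unit diagonal part `u` is merged into the right
  -- integral factor.
  have hsurj : LinearMap.range Φ = ⊤ := by
    classical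
    rw [eq_top_iff, ← he.span_range_hecke_eq_top hirr hconj, Submodule.span_le]
    rintro _ ⟨g, rfl⟩
    obtain ⟨P, hP, R, hR, d, hd, rfl⟩ := exists_cartan_decomposition g
    obtain ⟨c, δ, u, hu, rfl⟩ := exists_eq_scalar_mul_coweights hϖ p hp d hd
    have hz : diagGL F (l + 1) (fun _ => c) ∈ Subgroup.center (GL (Fin (l + 1)) F) := by
      rw [Subgroup.mem_center_iff]
      intro g
      apply Units.ext
      ext i j
      simp [diagGL_val, Matrix.mul_diagonal, Matrix.diagonal_mul, mul_comm]
    obtain ⟨a, ha⟩ := he.exists_hecke_eq_smul_one hirr hconj hz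
    have hzK : ∀ k ∈ K, diagGL F (l + 1) (fun _ => c) * k * (diagGL F (l + 1) fun _ => c)⁻¹ ∈ K := by
      intro k hk
      rwa [← Subgroup.mem_center_iff.1 hz, mul_inv_cancel_right]
    have huR : diagGL F (l + 1) u * R ∈ K₀ := mul_mem (diagGL_mem hu) hR
    set b := ∏ i, fundamentalCoweight p i ^ δ i with hb
    have hbC : he.hecke (diagGL F (l + 1) b) ∈ C := hecke_coweights_mem_adjoin hϖ hm he hp1 δ
    have hT : he.hecke (P * diagGL F (l + 1) ((fun _ => c) * b * u) * R) =
        he.hecke P * ((a • he.hecke (diagGL F (l + 1) b)) * he.hecke (diagGL F (l + 1) u * R)) := by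
      rw [map_mul, map_mul, show P * (diagGL F (l + 1) (fun _ => c) * diagGL F (l + 1) b *
        diagGL F (l + 1) u) * R = P * (diagGL F (l + 1) (fun _ => c) * (diagGL F (l + 1) b *
        (diagGL F (l + 1) u * R))) by simp only [mul_assoc],
        he.hecke_mul_of_normalizes_left (hnorm P hP), he.hecke_mul_of_normalizes_left hzK, ha,
        he.hecke_mul_of_normalizes_right _ (hnorm' _ huR), smul_mul_assoc, one_mul, smul_mul_assoc]
    rw [hT]
    refine ⟨Pi.single ((QuotientGroup.mk ⟨P, hP⟩ : Q), (QuotientGroup.mk ⟨_, huR⟩ : Q))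
      ⟨a • he.hecke (diagGL F (l + 1) b), C.smul_mem hbC a⟩, ?_⟩
    rw [hΦ, Finset.sum_eq_single ((QuotientGroup.mk ⟨P, hP⟩ : Q), (QuotientGroup.mk ⟨_, huR⟩ : Q))]
    · rw [Pi.single_eq_same, hout, hout]
    · intro q _ hq
      rw [Pi.single_eq_of_ne hq]
      simp
    · simp
  have hfree : Module.Free ℂ C := Module.Free.of_divisionRing ℂ C
  have hfinC : Module.Finite ℂ C := inferInstance
  have h1 := LinearMap.finrank_range_le Φ
  rw [hsurj, finrank_top, Module.finrank_linearMap, Module.finrank_pi_fintype] at h1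
  simpa [sq, hQ] using h1

theorem finrank_fixedVectors_le [LocallyCompactSpace F] (hirr : π.IsIrreducible)
    (hsm : IsSmooth π) (hadm : IsAdmissible π) :
    (Module.finrank ℂ (fixedVectors π (congruenceSubgroup (l + 1) hϖ m hm)) : ℝ) ≤
      ((congruenceSubgroup (l + 1) hϖ m hm).relIndex (integralGL F (l + 1)) : ℝ) ^ (l + 1) *
        ((l + 1 : ℕ) : ℝ) ^ (((l + 1 : ℕ) : ℝ) / 2) := by
  have hKc := isCompact_congruenceSubgroup (n := l + 1) hϖ hm
  have hfd := hadm _ (isOpen_congruenceSubgroup hϖ hm) hKc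
  obtain ⟨e, he⟩ := exists_isAverage (π := π) (K := congruenceSubgroup (l + 1) hϖ m hm) fun u => by
    obtain ⟨H, hHo, -, hH⟩ := hsm u
    exact ⟨H, finiteIndex_subgroupOf_of_isOpen hKc hHo, hH⟩
  let p : Fˣ := Units.mk0 (ϖ : F) (norm_pos_iff.1 hϖ.norm_pos)
  have hp1 : ‖(p : F)‖ ≤ 1 := hϖ.norm_lt_one.le
  have h1 := finrank_sq_le hϖ hm hirr he (p := p) rfl
  set D := Module.finrank ℂ (fixedVectors π (congruenceSubgroup (l + 1) hϖ m hm))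
  set N := (congruenceSubgroup (l + 1) hϖ m hm).relIndex (integralGL F (l + 1))
  rcases Nat.eq_zero_or_pos D with hD | hD
  · rw [hD, Nat.cast_zero]; positivity
  have hD0 : (0 : ℝ) < D := by exact_mod_cast hD
  -- Here `t = D ^ (2 / n)`; its positivity, which excludes `D = 0`, later allows cancelling `t ^
  -- l`.
  obtain ⟨t, ht, htl⟩ : ∃ t : ℝ, 0 < t ∧ t ^ (l + 1) = (D : ℝ) ^ 2 :=
    ⟨((D : ℝ) ^ 2) ^ (((l + 1 : ℕ) : ℝ)⁻¹), by positivity,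
      Real.rpow_inv_natCast_pow (by positivity) (Nat.succ_ne_zero l)⟩
  have h2 := finrank_adjoin_range_le (k := ℂ)
    (fun i => he.hecke (diagGL F _ (fundamentalCoweight p i))) (fun i j => by
      rw [← hecke_mul_coweight hϖ hm he hp1 (fundamentalCoweight_antitone hp1 i), mul_comm,
        hecke_mul_coweight hϖ hm he hp1 (fundamentalCoweight_antitone hp1 j)]) t ht htl
  have h3 : (D : ℝ) ^ 2 ≤ (N : ℝ) ^ 2 * ((l + 1) * t ^ l) := by
    refine le_trans (by exact_mod_cast h1) (mul_le_mul_of_nonneg_left h2 (by positivity))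
  have h4 : t ≤ (N : ℝ) ^ 2 * ((l + 1 : ℕ) : ℝ) := by
    rw [← htl, pow_succ', ← mul_assoc] at h3
    push_cast
    exact le_of_mul_le_mul_right h3 (pow_pos ht l)
  refine (pow_le_pow_iff_left₀ hD0.le (by positivity) two_ne_zero).1 ?_
  rw [mul_pow, natCast_rpow_half_sq, ← htl, ← pow_mul, mul_comm (l + 1) 2, pow_mul, ← mul_pow]
  exact pow_le_pow_left₀ ht.le h4 _

end Bound

end UniformAdmissibility

theorem mainTheorem4 {F : Type*} [NontriviallyNormedField F] [IsUltrametricDist F]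
    [LocallyCompactSpace F] (n : ℕ) (hn : 1 ≤ n)
    (ϖ : UniformAdmissibility.integers F) (hϖ : UniformAdmissibility.IsUniformizer ϖ)
    (m : ℕ) (hm : 1 ≤ m)
    {V : Type*} [AddCommGroup V] [Module ℂ V] (π : Representation ℂ (GL (Fin n) F) V)
    (hirr : π.IsIrreducible) (hsm : UniformAdmissibility.IsSmooth π)
    (hadm : UniformAdmissibility.IsAdmissible π) :
    (Module.finrank ℂ (UniformAdmissibility.fixedVectors π
        (UniformAdmissibility.congruenceSubgroup n hϖ m hm)) : ℝ) ≤
      (((UniformAdmissibility.congruenceSubgroup n hϖ m hm).relIndex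
        (UniformAdmissibility.integralGL F n) : ℕ) : ℝ) ^ n * (n : ℝ) ^ ((n : ℝ) / 2) ∧
    (3 ≤ n →
      (((UniformAdmissibility.congruenceSubgroup n hϖ m hm).relIndex
        (UniformAdmissibility.integralGL F n) : ℕ) : ℝ) ^ n * (n : ℝ) ^ ((n : ℝ) / 2) <
      (((UniformAdmissibility.congruenceSubgroup n hϖ m hm).relIndex
        (UniformAdmissibility.integralGL F n) : ℕ) : ℝ) ^ (2 ^ (n - 1))) := by
  obtain ⟨l, rfl⟩ := Nat.exists_eq_add_of_le' hn
  exact ⟨UniformAdmissibility.finrank_fixedVectors_le hϖ hm hirr hsm hadm, fun h3 =>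
    UniformAdmissibility.pow_mul_rpow_lt_pow_two_pow h3
      (UniformAdmissibility.factorial_le_relIndex hϖ hm)⟩
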